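/- Theorem 1.3. For infinitely many integers $n$ there is a closed polygonal curve $P_n$ embedded in $\mathbb{R}^3$, consisting of $n$ line segments (no two consecutive ones lying on a common line), such that every complementary immersed oriented triangulated PL surface that has a PL subdivision of $P_n$ as its boundary contains at least $n^2/36$ triangles. Here an oriented triangulated PL surface is a compact oriented surface, of any genus, with a finite triangulation, together with a map to $\mathbb{R}^3$ that is affine on each triangle. It is immersed if this map is locally injective, and complementary immersed if in addition the map is injective on the boundary of the surface and the image of the interior of the surface is disjoint from the image of its boundary. The surface has a PL subdivision of $P_n$ as its boundary if the image of its boundary is the curve $P_n$, so that the edges of the boundary subdivide those of $P_n$. -/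

import Mathlib

open scoped Finset

/-- Euclidean three-space. -/
abbrev E3 : Type := EuclideanSpace ℝ (Fin 3)

/-- The closed polygon `P`, whose `i`-th edge joins the `i`-th vertex to the cyclically next one,
is embedded and consists of exactly `n` line segments: consecutive edges meet only in their common
vertex, other edges are disjoint, and the polygon really turns at each vertex, so that no two
consecutive edges form a single segment. -/
structure IsEmbeddedPolygon {n : ℕ} (P : Polygon E3 n) : Prop where
  three_le : 3 ≤ n
  not_collinear : ∀ i : Fin n,
    ¬ Collinear ℝ {P i, P (finRotate n i), P (finRotate n (finRotate n i))}
  consecutive : ∀ i : Fin n,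
    P.edgeSet ℝ i ∩ P.edgeSet ℝ (finRotate n i) = {P (finRotate n i)}
  disjoint : ∀ i j : Fin n, i ≠ j → j ≠ finRotate n i → i ≠ finRotate n j →
    Disjoint (P.edgeSet ℝ i) (P.edgeSet ℝ j)

/-- The link of the vertex `v` in the pure two-dimensional simplicial complex with set of
triangles `T`: a graph on the neighbours of `v`, where `u` and `w` are joined when `v`, `u`, `w`
span a triangle. -/
def linkGraph {V : Type*} [DecidableEq V] (T : Finset (Finset V)) (v : V) :
    SimpleGraph {w : V // w ≠ v ∧ ∃ t ∈ T, v ∈ t ∧ w ∈ t} where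
  Adj u w := u ≠ w ∧ ({v, u.1, w.1} : Finset V) ∈ T
  symm := ⟨fun u w h => ⟨h.1.symm, by
    have e : ({v, w.1, u.1} : Finset V) = {v, u.1, w.1} := by
      rw [Finset.pair_comm]
    rw [e]; exact h.2⟩⟩
  loopless := ⟨fun _ h => h.1 rfl⟩

/-- A compact triangulated surface, possibly with boundary and possibly disconnected, of any genus:
a finite simplicial complex with vertex set `V`, given by its triangles, in which each vertex and
each edge belongs to a triangle, each edge belongs to at most two triangles, and the link of each
vertex is connected (so that the link is an arc or a circle). -/
structure TriangulatedSurface (V : Type*) [Fintype V] [DecidableEq V] where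
  triangles : Finset (Finset V)
  card_eq_three : ∀ t ∈ triangles, #t = 3
  edge_le_two : ∀ a b : V, a ≠ b → #{t ∈ triangles | a ∈ t ∧ b ∈ t} ≤ 2
  link_connected : ∀ v : V, (linkGraph triangles v).Connected

namespace TriangulatedSurface

variable {V : Type*} [Fintype V] [DecidableEq V] (S : TriangulatedSurface V)

/-- `O a b c` says that the triangle with vertices `a`, `b`, `c` is given the orientation in which
`a`, `b`, `c` is the positive cyclic order. Each triangle has exactly one orientation, and two
triangles with a common edge induce opposite orientations on it. -/
structure IsOrientation (O : V → V → V → Prop) : Prop where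
  cyclic : ∀ a b c : V, {a, b, c} ∈ S.triangles → O a b c → O b c a
  reverse : ∀ a b c : V, {a, b, c} ∈ S.triangles → (O b a c ↔ ¬ O a b c)
  coherent : ∀ a b c d : V, {a, b, c} ∈ S.triangles → {a, b, d} ∈ S.triangles → c ≠ d →
    O a b c → O b a d

/-- The surface can be oriented. -/
def Orientable : Prop := ∃ O : V → V → V → Prop, S.IsOrientation O

/-- The underlying space of the surface, in barycentric coordinates. -/
def carrier : Set (V → ℝ) :=
  {x | x ∈ stdSimplex ℝ V ∧ ∃ t ∈ S.triangles, ∀ v, x v ≠ 0 → v ∈ t}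

/-- A boundary edge is an edge that belongs to exactly one triangle. -/
def IsBoundaryEdge (a b : V) : Prop :=
  a ≠ b ∧ #{t ∈ S.triangles | a ∈ t ∧ b ∈ t} = 1

/-- The boundary of the surface, in barycentric coordinates: the union of the boundary edges. -/
def boundary : Set (V → ℝ) :=
  {x | x ∈ stdSimplex ℝ V ∧ ∃ a b, S.IsBoundaryEdge a b ∧ ∀ v, x v ≠ 0 → v = a ∨ v = b}

/-- The interior of the surface. -/
def interior : Set (V → ℝ) := S.carrier \ S.boundary

/-- The map that is affine on each triangle and sends each vertex `v` to `p v`. -/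
noncomputable def realize (p : V → E3) (x : V → ℝ) : E3 := ∑ v, x v • p v

/-- The triangulated surface with vertices placed by `p` is a complementary immersed surface: it is
immersed (mapped in a locally injective way), its boundary is embedded, and the image of its
interior does not meet the image of its boundary. -/
structure IsComplementaryImmersed (p : V → E3) : Prop where
  immersed : IsLocallyInjective (S.carrier.domRestrict (realize p))
  boundary_embedded : S.boundary.InjOn (realize p)
  complementary : Disjoint (realize p '' S.interior) (realize p '' S.boundary)

/-- The boundary of the surface is mapped onto the polygon. When the boundary is embedded and
the polygon turns at all its vertices, the boundary edges then subdivide the polygon's edges. -/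
def Bounds (p : V → E3) {n : ℕ} (P : Polygon E3 n) : Prop :=
  realize p '' S.boundary = P.boundary ℝ

end TriangulatedSurface

/-! The lower bound comes from a linking number. Push an embedded polygon `P` off itself by a small
generic translation `w`. If `P` bounds an oriented surface, the algebraic number of intersections of
`P + w` with the surface is, up to sign, the linking number of `P` with `P + w`, so it does not
depend on the surface. Each triangle absorbs at most three units of it, so a polygon whose linking
number is quadratic in the number of edges needs quadratically many triangles.

Independence of the surface: fix an apex `o`. A triangle differs from the three cones over its sides
by the boundary of a tetrahedron, which a closed polygon crosses algebraically zero times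
(`exists_signedHit_tetrahedron`). Summing over the surface leaves only the cones over its boundary
edges (`two_mul_sum_signedHit`). The oriented boundary is a cycle carried by a simple closed
polygon, hence it is `P` or its reverse; this is detected by a potential along `P` that jumps at a
single vertex (`exists_potential`, `Bounds.abs_sum_boundaryCoeff_mul`). What remains is
`coneLinking`.

Bound per triangle: the interior of the surface misses `P`, so a triangle can meet an edge of `P`
only if one of its vertices lies on that edge. By compactness the same restriction governs the
translate for small `w`. A vertex lies on at most two edges, which are consecutive, and two
consecutive edges together cross a triangle algebraically at most once. Hence at most three per
triangle (`Bounds.abs_coneLinking_le`).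

The polygon: place `n = 3k` vertices on the moment curve and visit the parameters in the order `0,
k, 2k, 1, k+1, 2k+1, 2, ...`. Vandermonde determinants make it embedded and reduce its crossings
with a cone, whose apex precedes all vertices, to the interleaving of parameter intervals. Away from
the last block, each two distinct blocks of three edges contribute one unit, and only linearly many
units are lost, so for large `k` the linking number is at least `3k²/4` in absolute value
(`exists_polygon_coneLinking`). Thus there are at least `k²/4 = n²/36` triangles. -/

/-! ### Signed intersections of a segment with a triangle -/

/-- The determinant of three vectors of `E3`. -/
def vol (u v w : E3) : ℝ :=
  u 0 * (v 1 * w 2 - v 2 * w 1) - u 1 * (v 0 * w 2 - v 2 * w 0) + u 2 * (v 0 * w 1 - v 1 * w 0)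

/-- The triangle with given vertices. -/
def solidTriangle (a b c : E3) : Set E3 :=
  {z | ∃ α β γ : ℝ, 0 ≤ α ∧ 0 ≤ β ∧ 0 ≤ γ ∧ α + β + γ = 1 ∧ z = α • a + β • b + γ • c}

/-- The segment `xy` meets the triangle `abc`. -/
def Hits (x y a b c : E3) : Prop := ∃ z ∈ segment ℝ x y, z ∈ solidTriangle a b c

open Classical in
/-- The signed intersection number of the segment `xy` with the triangle `abc`. -/
noncomputable def signedHit (x y a b c : E3) : ℤ :=
  if Hits x y a b c then (SignType.sign (vol (y - x) (b - a) (c - a)) : ℤ) else 0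

theorem solidTriangle_swap (a b c : E3) : solidTriangle b a c = solidTriangle a b c := by
  ext z
  constructor <;> rintro ⟨α, β, γ, h1, h2, h3, h4, rfl⟩ <;>
    exact ⟨β, α, γ, h2, h1, h3, by linarith, by abel⟩

theorem solidTriangle_rotate (a b c : E3) : solidTriangle b c a = solidTriangle a b c := by
  ext z
  constructor
  · rintro ⟨α, β, γ, h1, h2, h3, h4, rfl⟩
    exact ⟨γ, α, β, h3, h1, h2, by linarith, by abel⟩
  · rintro ⟨α, β, γ, h1, h2, h3, h4, rfl⟩
    exact ⟨β, γ, α, h2, h3, h1, by linarith, by abel⟩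

theorem signedHit_rotate (x y a b c : E3) : signedHit x y b c a = signedHit x y a b c := by
  have e : vol (y - x) (c - b) (a - b) = vol (y - x) (b - a) (c - a) := by
    simp [vol]; ring
  have h : Hits x y b c a ↔ Hits x y a b c := by simp only [Hits, solidTriangle_rotate a b c]
  by_cases k : Hits x y a b c
  · simp [signedHit, k, h.2 k, e]
  · simp [signedHit, k, mt h.1 k]

theorem signedHit_swap (x y a b c : E3) : signedHit x y b a c = -signedHit x y a b c := by
  have e : vol (y - x) (a - b) (c - b) = -vol (y - x) (b - a) (c - a) := by
    simp [vol]; ring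
  have h : Hits x y b a c ↔ Hits x y a b c := by simp only [Hits, solidTriangle_swap a b c]
  by_cases k : Hits x y a b c
  · simp [signedHit, k, h.2 k, e, Left.sign_neg]
  · simp [signedHit, k, mt h.1 k]

theorem signedHit_antisymm (x y o a b : E3) : signedHit x y o b a = -signedHit x y o a b := by
  rw [← signedHit_rotate x y o b a, signedHit_swap x y a b o, signedHit_rotate x y o a b]

theorem signedHit_segment_swap (x y a b c : E3) : signedHit y x a b c = -signedHit x y a b c := by
  have e : vol (x - y) (b - a) (c - a) = -vol (y - x) (b - a) (c - a) := by
    simp [vol]; ring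
  have h : Hits y x a b c ↔ Hits x y a b c := by simp only [Hits, segment_symm ℝ y x]
  by_cases k : Hits x y a b c
  · simp [signedHit, k, h.2 k, e, Left.sign_neg]
  · simp [signedHit, k, mt h.1 k]

theorem signedHit_self (x y o a : E3) : signedHit x y o a a = 0 := by
  have := signedHit_antisymm x y o a a
  omega

theorem abs_sign_le_one (r : ℝ) : |(SignType.sign r : ℤ)| ≤ 1 := by
  rcases lt_trichotomy r 0 with h | h | h <;> simp [h]

theorem abs_signedHit_le_one (x y a b c : E3) : |signedHit x y a b c| ≤ 1 := by
  unfold signedHit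
  split_ifs
  · exact abs_sign_le_one _
  · simp

theorem hits_of_signedHit_ne_zero {x y a b c : E3} (h : signedHit x y a b c ≠ 0) :
    Hits x y a b c := by
  by_contra h'
  exact h (by simp [signedHit, h'])

theorem exists_combo_of_mem_segment {x y z : E3} (h : z ∈ segment ℝ x y) :
    ∃ t : ℝ, 0 ≤ t ∧ t ≤ 1 ∧ z = (1 - t) • x + t • y := by
  obtain ⟨a, b, ha, hb, hab, rfl⟩ := h
  exact ⟨b, hb, by linarith, by rw [← hab]; simp⟩

theorem combo_mem_segment {x y : E3} {t : ℝ} (h0 : 0 ≤ t) (h1 : t ≤ 1) :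
    (1 - t) • x + t • y ∈ segment ℝ x y :=
  ⟨1 - t, t, by linarith, h0, by ring, rfl⟩

/-- Two consecutive segments cannot both hit a triangle with the same sign, unless their common end
point lies on the triangle. -/
theorem abs_signedHit_add_le_one {x y z a b c : E3} (hy : y ∉ solidTriangle a b c) :
    |signedHit x y a b c + signedHit y z a b c| ≤ 1 := by
  have key : ∀ s : ℝ, s ≠ 0 → Hits x y a b c → Hits y z a b c →
      0 < s * vol (y - x) (b - a) (c - a) → 0 < s * vol (z - y) (b - a) (c - a) → False := by
    rintro s hs ⟨p, hp, hpt⟩ ⟨q, hq, hqt⟩ h1 h2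
    obtain ⟨t, ht0, ht1, hpe⟩ := exists_combo_of_mem_segment hp
    obtain ⟨u, hu0, hu1, hqe⟩ := exists_combo_of_mem_segment hq
    have hpy : p ≠ y := by rintro rfl; exact hy hpt
    have ht : t < 1 := by
      refine lt_of_le_of_ne ht1 ?_
      rintro rfl
      apply hpy; rw [hpe]; simp
    -- Both hitting points lie in the plane of the triangle, while `q - p = (1 - t) • (y - x) + u •
    -- (z - y)` moves strictly across it when the two signs agree, since `t < 1`.
    have hpq : vol (q - p) (b - a) (c - a) = 0 := by
      obtain ⟨α, β, γ, -, -, -, hs1, rfl⟩ := hpt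
      obtain ⟨α', β', γ', -, -, -, hs2, rfl⟩ := hqt
      obtain rfl : α = 1 - β - γ := by linarith
      obtain rfl : α' = 1 - β' - γ' := by linarith
      simp [vol]; ring
    have e : vol (q - p) (b - a) (c - a) =
        (1 - t) * vol (y - x) (b - a) (c - a) + u * vol (z - y) (b - a) (c - a) := by
      rw [hpe, hqe]; simp [vol]; ring
    have : s * vol (q - p) (b - a) (c - a) = (1 - t) * (s * vol (y - x) (b - a) (c - a)) +
        u * (s * vol (z - y) (b - a) (c - a)) := by rw [e]; ring
    rw [hpq] at this
    have h3 : 0 < (1 - t) * (s * vol (y - x) (b - a) (c - a)) := mul_pos (by linarith) h1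
    have h4 : 0 ≤ u * (s * vol (z - y) (b - a) (c - a)) := mul_nonneg hu0 h2.le
    linarith
  unfold signedHit
  split_ifs with h1 h2 h2
  · rcases lt_trichotomy (vol (y - x) (b - a) (c - a)) 0 with g | g | g <;>
      rcases lt_trichotomy (vol (z - y) (b - a) (c - a)) 0 with g' | g' | g' <;> simp [g, g']
    · exact key (-1) (by norm_num) h1 h2 (by linarith) (by linarith)
    · exact key 1 (by norm_num) h1 h2 (by linarith) (by linarith)
  · simpa using abs_sign_le_one _
  · simpa using abs_sign_le_one _
  · simp

/-- Additivity of the intersection number with triangles of apex `o` along a segment. -/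
theorem signedHit_add_of_mem_segment {x y o a b c : E3} (hb : b ∈ segment ℝ a c)
    (hgen : Disjoint (segment ℝ x y) (segment ℝ o b)) :
    signedHit x y o a b + signedHit x y o b c = signedHit x y o a c := by
  obtain ⟨l, hl0, hl1, rfl⟩ := exists_combo_of_mem_segment hb
  rcases eq_or_lt_of_le hl0 with rfl | hl0'
  · simp [signedHit_self]
  rcases eq_or_lt_of_le hl1 with rfl | hl1'
  · simp [signedHit_self]
  set b := (1 - l) • a + l • c with hbdef
  set D := vol (y - x) (a - o) (c - o) with hD
  have e1 : vol (y - x) (a - o) (b - o) = l * D := by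
    rw [hD, hbdef]; simp [vol]; ring
  have e2 : vol (y - x) (b - o) (c - o) = (1 - l) * D := by
    rw [hD, hbdef]; simp [vol]; ring
  have s1 : SignType.sign (l * D) = SignType.sign D := by
    rw [sign_mul, sign_pos hl0', one_mul]
  have s2 : SignType.sign ((1 - l) * D) = SignType.sign D := by
    rw [sign_mul, sign_pos (by linarith : 0 < 1 - l), one_mul]
  unfold signedHit
  rw [e1, e2, s1, s2, ← hD]
  by_cases hD0 : D = 0
  · simp [hD0]
  have h1 : Hits x y o a b → Hits x y o a c := by
    rintro ⟨z, hz, α, β, γ, h1, h2, h3, h4, rfl⟩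
    refine ⟨_, hz, α, β + γ * (1 - l), γ * l, h1, by nlinarith, by nlinarith, by linarith, ?_⟩
    rw [hbdef]; module
  have h2 : Hits x y o b c → Hits x y o a c := by
    rintro ⟨z, hz, α, β, γ, h1, h2, h3, h4, rfl⟩
    refine ⟨_, hz, α, β * (1 - l), γ + β * l, h1, by nlinarith, by nlinarith, by linarith, ?_⟩
    rw [hbdef]; module
  have h3 : Hits x y o a c → Hits x y o a b ∨ Hits x y o b c := by
    rintro ⟨z, hz, α, β, γ, h1, h2, h3, h4, rfl⟩
    have hl1'' : 0 < 1 - l := by linarith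
    -- This compares the point with the line `ob`: the inequality puts it on the side of `a`, so `c`
    -- can be eliminated in favour of `b`; otherwise `a` can.
    by_cases hc : γ * (1 - l) ≤ l * β
    · left
      refine ⟨_, hz, α, β - γ * (1 - l) / l, γ / l, h1, ?_, by positivity, ?_, ?_⟩
      · rw [sub_nonneg, div_le_iff₀ hl0']; linarith
      · field_simp; linear_combination l * h4
      · have hl : l ≠ 0 := hl0'.ne'
        have : (γ / l) • b = (γ * (1 - l) / l) • a + γ • c := by
          rw [hbdef, smul_add, smul_smul, smul_smul, div_mul_cancel₀ _ hl]
          congr 2; ring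
        rw [this]; module
    · right
      push Not at hc
      refine ⟨_, hz, α, β / (1 - l), γ - β * l / (1 - l), h1, by positivity, ?_, ?_, ?_⟩
      · rw [sub_nonneg, div_le_iff₀ hl1'']; linarith
      · field_simp; linear_combination (1 - l) * h4
      · have : (β / (1 - l)) • b = β • a + (β * l / (1 - l)) • c := by
          rw [hbdef, smul_add, smul_smul, smul_smul, div_mul_cancel₀ _ hl1''.ne']
          congr 2; ring
        rw [this]; module
  -- As `D ≠ 0`, the segment meets the plane only once, so both hits would occur at a common point
  -- of the two subtriangles, which lies on `ob`.
  have h4 : Hits x y o a b → Hits x y o b c → False := by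
    rintro ⟨p, hp, α, β, γ, a1, a2, a3, a4, hpe⟩ ⟨q, hq, α', β', γ', b1, b2, b3, b4, hqe⟩
    obtain ⟨t, ht0, ht1, hpt⟩ := exists_combo_of_mem_segment hp
    obtain ⟨u, hu0, hu1, hqt⟩ := exists_combo_of_mem_segment hq
    have hpq : vol (q - p) (a - o) (c - o) = 0 := by
      obtain rfl : α = 1 - β - γ := by linarith
      obtain rfl : α' = 1 - β' - γ' := by linarith
      rw [hpe, hqe, hbdef]
      simp [vol]; ring
    have h5 : vol (q - p) (a - o) (c - o) = (u - t) * D := by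
      rw [hpt, hqt, hD]; simp [vol]; ring
    have hut : u = t := by
      have := h5.symm.trans hpq
      rcases mul_eq_zero.mp this with h | h
      · linarith
      · exact absurd h hD0
    have hpq' : p = q := by rw [hpt, hqt, hut]
    have hz : (α - α') • o + (β + γ * (1 - l) - β' * (1 - l)) • a +
        (γ * l - β' * l - γ') • c = 0 := by
      have : p - q = 0 := by rw [hpq']; simp
      rw [hpe, hqe, hbdef] at this
      rw [← this]; module
    have hB : β = 0 := by
      have hv : vol (y - x) ((α - α') • o + (β + γ * (1 - l) - β' * (1 - l)) • a +
        (γ * l - β' * l - γ') • c) (c - o) = (β + γ * (1 - l) - β' * (1 - l)) * D := by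
        obtain rfl : α = 1 - β - γ := by linarith
        obtain rfl : α' = 1 - β' - γ' := by linarith
        rw [hD]; simp [vol]; ring
      have hv' : vol (y - x) (a - o) ((α - α') • o + (β + γ * (1 - l) - β' * (1 - l)) • a +
        (γ * l - β' * l - γ') • c) = (γ * l - β' * l - γ') * D := by
        obtain rfl : α = 1 - β - γ := by linarith
        obtain rfl : α' = 1 - β' - γ' := by linarith
        rw [hD]; simp [vol]; ring
      rw [hz] at hv hv'
      have z1 : β + γ * (1 - l) - β' * (1 - l) = 0 := by
        have : (β + γ * (1 - l) - β' * (1 - l)) * D = 0 := by rw [← hv]; simp [vol]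
        exact (mul_eq_zero.mp this).resolve_right hD0
      have z2 : γ * l - β' * l - γ' = 0 := by
        have : (γ * l - β' * l - γ') * D = 0 := by rw [← hv']; simp [vol]
        exact (mul_eq_zero.mp this).resolve_right hD0
      have : l * β = -((1 - l) * γ') := by nlinarith
      nlinarith [mul_nonneg hl0 a2, mul_nonneg (by linarith : (0:ℝ) ≤ 1 - l) b3]
    refine Set.disjoint_left.mp hgen hp ⟨α, γ, a1, a3, by linarith, ?_⟩
    rw [hpe, hB]; simp
  by_cases k1 : Hits x y o a b <;> by_cases k2 : Hits x y o b c
  · exact (h4 k1 k2).elim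
  · simp [k1, k2, h1 k1]
  · simp [k1, k2, h2 k2]
  · have : ¬ Hits x y o a c := fun h => (h3 h).elim k1 k2
    simp [k1, k2, this]

/-! ### Zeros of affine functions on an interval -/

/-- If finitely many affine functions on `[0, 1]` have a common nonnegative point, but are not all
nonnegative at `0`, then exactly one of them vanishes with positive slope at a common
nonnegative point. -/
theorem card_increasing_roots {ι : Type*} [Fintype ι] (α β : ι → ℝ)
    (h0 : (∀ j, 0 ≤ α j) → ∀ i, α i ≠ 0)
    (hgen : ∀ t : ℝ, 0 ≤ t → t ≤ 1 → (∀ j, 0 ≤ (1 - t) * α j + t * β j) →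
      ∀ i i', (1 - t) * α i + t * β i = 0 → (1 - t) * α i' + t * β i' = 0 → i = i')
    (hne : ∃ t : ℝ, 0 ≤ t ∧ t ≤ 1 ∧ ∀ j, 0 ≤ (1 - t) * α j + t * β j)
    [DecidablePred fun i => α i < β i ∧ ∃ t : ℝ, 0 ≤ t ∧ t ≤ 1 ∧
      (∀ j, 0 ≤ (1 - t) * α j + t * β j) ∧ (1 - t) * α i + t * β i = 0]
    [Decidable (∀ j, 0 ≤ α j)] :
    #{i | α i < β i ∧ ∃ t : ℝ, 0 ≤ t ∧ t ≤ 1 ∧ (∀ j, 0 ≤ (1 - t) * α j + t * β j) ∧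
      (1 - t) * α i + t * β i = 0} = if ∀ j, 0 ≤ α j then 0 else 1 := by
  split_ifs with hC
  · rw [Finset.card_eq_zero, Finset.filter_eq_empty_iff]
    rintro i - ⟨hi, t, ht0, ht1, -, hr⟩
    have h1 := hC i
    have h2 := h0 hC i
    have h3 : 0 < α i := lt_of_le_of_ne h1 (Ne.symm h2)
    nlinarith
  · obtain ⟨t, ht0, ht1, htC⟩ := hne
    push Not at hC
    obtain ⟨j0, hj0⟩ := hC
    have slope : ∀ j, α j < 0 → α j < β j := fun j hj => by
      by_contra hcon
      have := htC j
      nlinarith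
    -- The interval of common nonnegativity begins at the largest root among the functions that are
    -- negative at `0`.
    obtain ⟨i, hi, hmax⟩ := Finset.exists_max_image {j | α j < 0} (fun j => -α j / (β j - α j))
      ⟨j0, by simpa using hj0⟩
    simp only [Finset.mem_filter, Finset.mem_univ, true_and] at hi hmax
    have hsi := slope i hi
    set r := -α i / (β i - α i) with hr
    have hrr : r * (β i - α i) = -α i := div_mul_cancel₀ _ (by linarith)
    have hr0 : 0 ≤ r := div_nonneg (by linarith) (by linarith)
    have hrt : r ≤ t := by
      rw [hr, div_le_iff₀ (by linarith)]
      have := htC i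
      linarith
    have hrC : ∀ j, 0 ≤ (1 - r) * α j + r * β j := by
      intro j
      rcases lt_or_ge (α j) 0 with hj | hj
      · have h1 := hmax j hj
        have h2 := slope j hj
        rw [div_le_iff₀ (by linarith)] at h1
        linarith
      · have h1 := htC j
        by_cases hab : α j ≤ β j
        · nlinarith
        · nlinarith
    rw [Finset.card_eq_one]
    refine ⟨i, ?_⟩
    ext i'
    simp only [Finset.mem_filter, Finset.mem_univ, true_and, Finset.mem_singleton]
    constructor
    · rintro ⟨hi', u, hu0, hu1, huC, hu⟩
      have h1 := huC i
      have h2 := hrC i'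
      have : u = r := by
        apply le_antisymm
        · nlinarith
        · nlinarith
      subst this
      exact hgen _ hu0 hu1 huC i' i hu (by linarith)
    · rintro rfl
      exact ⟨hsi, r, hr0, hrt.trans ht1, hrC, by linarith⟩

/-- The signed number of zeros of finitely many affine functions on `[0, 1]` on the boundary of
the interval where all of them are nonnegative. -/
theorem sum_sign_roots {ι : Type*} [Fintype ι] (α β : ι → ℝ)
    (h0 : (∀ j, 0 ≤ α j) → ∀ i, α i ≠ 0) (h1 : (∀ j, 0 ≤ β j) → ∀ i, β i ≠ 0)
    (hgen : ∀ t : ℝ, 0 ≤ t → t ≤ 1 → (∀ j, 0 ≤ (1 - t) * α j + t * β j) →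
      ∀ i i', (1 - t) * α i + t * β i = 0 → (1 - t) * α i' + t * β i' = 0 → i = i')
    [DecidablePred fun i => ∃ t : ℝ, 0 ≤ t ∧ t ≤ 1 ∧
      (∀ j, 0 ≤ (1 - t) * α j + t * β j) ∧ (1 - t) * α i + t * β i = 0]
    [Decidable (∀ j, 0 ≤ α j)] [Decidable (∀ j, 0 ≤ β j)] :
    (∑ i, if ∃ t : ℝ, 0 ≤ t ∧ t ≤ 1 ∧ (∀ j, 0 ≤ (1 - t) * α j + t * β j) ∧
        (1 - t) * α i + t * β i = 0 then (SignType.sign (β i - α i) : ℤ) else 0) =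
      (if ∀ j, 0 ≤ β j then 1 else 0) - (if ∀ j, 0 ≤ α j then 1 else 0) := by
  classical
  by_cases hne : ∃ t : ℝ, 0 ≤ t ∧ t ≤ 1 ∧ ∀ j, 0 ≤ (1 - t) * α j + t * β j
  · have A := card_increasing_roots α β h0 hgen hne
    have flip : ∀ P : ℝ → Prop, (∃ t : ℝ, 0 ≤ t ∧ t ≤ 1 ∧ P t) →
        ∃ t : ℝ, 0 ≤ t ∧ t ≤ 1 ∧ P (1 - t) := by
      rintro P ⟨t, a, b, c⟩
      exact ⟨1 - t, by linarith, by linarith, by simpa using c⟩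
    -- Reversing the parameter turns the zero where the interval is left into one where it is
    -- entered.
    have B := card_increasing_roots β α h1
      (fun t t0 t1 h i i' hi hi' => hgen (1 - t) (by linarith) (by linarith)
        (fun j => by linarith [h j]) i i' (by linarith) (by linarith))
      (by
        obtain ⟨t, a, b, c⟩ := flip _ hne
        exact ⟨t, a, b, fun j => by linarith [c j]⟩)
    have key : ∀ i, (if ∃ t : ℝ, 0 ≤ t ∧ t ≤ 1 ∧ (∀ j, 0 ≤ (1 - t) * α j + t * β j) ∧
        (1 - t) * α i + t * β i = 0 then (SignType.sign (β i - α i) : ℤ) else 0) =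
        (if α i < β i ∧ ∃ t : ℝ, 0 ≤ t ∧ t ≤ 1 ∧ (∀ j, 0 ≤ (1 - t) * α j + t * β j) ∧
          (1 - t) * α i + t * β i = 0 then 1 else 0) -
        (if β i < α i ∧ ∃ t : ℝ, 0 ≤ t ∧ t ≤ 1 ∧ (∀ j, 0 ≤ (1 - t) * β j + t * α j) ∧
          (1 - t) * β i + t * α i = 0 then 1 else 0) := by
      intro i
      have e : (∃ t : ℝ, 0 ≤ t ∧ t ≤ 1 ∧ (∀ j, 0 ≤ (1 - t) * β j + t * α j) ∧
          (1 - t) * β i + t * α i = 0) ↔ ∃ t : ℝ, 0 ≤ t ∧ t ≤ 1 ∧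
          (∀ j, 0 ≤ (1 - t) * α j + t * β j) ∧ (1 - t) * α i + t * β i = 0 := by
        constructor <;> intro h <;> obtain ⟨t, a, b, c, d⟩ := flip _ h <;>
          exact ⟨t, a, b, fun j => by linarith [c j], by linarith⟩
      rw [e]
      by_cases k : ∃ t : ℝ, 0 ≤ t ∧ t ≤ 1 ∧ (∀ j, 0 ≤ (1 - t) * α j + t * β j) ∧
          (1 - t) * α i + t * β i = 0
      · simp only [k, and_true, if_true]
        rcases lt_trichotomy (α i) (β i) with h | h | h
        · simp [h, h.not_gt, sign_pos (sub_pos.2 h)]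
        · simp [h]
        · simp [h, h.not_gt, sign_neg (sub_neg.2 h)]
      · simp only [k, and_false, if_false, sub_zero]
    rw [Finset.sum_congr rfl fun i _ => key i, Finset.sum_sub_distrib, Finset.sum_boole,
      Finset.sum_boole, A, B]
    split_ifs <;> simp
  · have n0 : ¬ ∀ j, 0 ≤ α j := fun h => hne ⟨0, le_rfl, zero_le_one, by simpa using h⟩
    have n1 : ¬ ∀ j, 0 ≤ β j := fun h => hne ⟨1, zero_le_one, le_rfl, by simpa using h⟩
    rw [if_neg n0, if_neg n1, sub_zero]
    refine Finset.sum_eq_zero fun i _ => if_neg ?_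
    rintro ⟨t, a, b, c, -⟩
    exact hne ⟨t, a, b, c⟩

/-! ### Crossings with the boundary of a tetrahedron -/

/-- The segment `xy` is in general position with respect to the set of points `Z`: it misses all
segments, and its end points miss all triangles, with vertices in `Z`. -/
structure IsGenericSegment (Z : Set E3) (x y : E3) : Prop where
  left : ∀ a ∈ Z, ∀ b ∈ Z, ∀ c ∈ Z, x ∉ solidTriangle a b c
  right : ∀ a ∈ Z, ∀ b ∈ Z, ∀ c ∈ Z, y ∉ solidTriangle a b c
  disjoint : ∀ a ∈ Z, ∀ b ∈ Z, Disjoint (segment ℝ x y) (segment ℝ a b)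

/-- The barycentric coordinates of `z` in the tetrahedron `oabc`. -/
noncomputable def tetraCoord (o a b c z : E3) : Fin 4 → ℝ :=
  ![1 - vol (z - o) (b - o) (c - o) / vol (a - o) (b - o) (c - o) -
      vol (a - o) (z - o) (c - o) / vol (a - o) (b - o) (c - o) -
      vol (a - o) (b - o) (z - o) / vol (a - o) (b - o) (c - o),
    vol (z - o) (b - o) (c - o) / vol (a - o) (b - o) (c - o),
    vol (a - o) (z - o) (c - o) / vol (a - o) (b - o) (c - o),
    vol (a - o) (b - o) (z - o) / vol (a - o) (b - o) (c - o)]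

theorem tetraCoord_sum (o a b c z : E3) :
    tetraCoord o a b c z 0 + tetraCoord o a b c z 1 + tetraCoord o a b c z 2 +
      tetraCoord o a b c z 3 = 1 := by
  simp [tetraCoord]; ring

/-- Cramer's rule for `z - o` in the basis `a - o`, `b - o`, `c - o`. -/
theorem eq_tetraCoord_combo {o a b c : E3} (hD : vol (a - o) (b - o) (c - o) ≠ 0) (z : E3) :
    z = tetraCoord o a b c z 0 • o + tetraCoord o a b c z 1 • a + tetraCoord o a b c z 2 • b +
      tetraCoord o a b c z 3 • c := by
  have key : ∀ i : Fin 3, (vol (a - o) (b - o) (c - o)) * (z i - o i) =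
      vol (z - o) (b - o) (c - o) * (a i - o i) + vol (a - o) (z - o) (c - o) * (b i - o i) +
      vol (a - o) (b - o) (z - o) * (c i - o i) := by
    intro i
    fin_cases i <;> simp [vol] <;> ring
  ext i
  have := key i
  simp only [tetraCoord, Matrix.cons_val, PiLp.add_apply, PiLp.smul_apply, smul_eq_mul]
  set D := vol (a - o) (b - o) (c - o)
  field_simp
  linarith

theorem tetraCoord_combo {o a b c : E3} (x y : E3) (t : ℝ) (i : Fin 4) :
    tetraCoord o a b c ((1 - t) • x + t • y) i =
      (1 - t) * tetraCoord o a b c x i + t * tetraCoord o a b c y i := by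
  have e1 : vol ((1 - t) • x + t • y - o) (b - o) (c - o) =
      (1 - t) * vol (x - o) (b - o) (c - o) + t * vol (y - o) (b - o) (c - o) := by
    simp [vol]; ring
  have e2 : vol (a - o) ((1 - t) • x + t • y - o) (c - o) =
      (1 - t) * vol (a - o) (x - o) (c - o) + t * vol (a - o) (y - o) (c - o) := by
    simp [vol]; ring
  have e3 : vol (a - o) (b - o) ((1 - t) • x + t • y - o) =
      (1 - t) * vol (a - o) (b - o) (x - o) + t * vol (a - o) (b - o) (y - o) := by
    simp [vol]; ring
  fin_cases i <;> simp [tetraCoord, e1, e2, e3] <;> ring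

theorem tetraCoord_of_combo {o a b c : E3} (hD : vol (a - o) (b - o) (c - o) ≠ 0)
    {w x y z : ℝ} (h : w + x + y + z = 1) :
    tetraCoord o a b c (w • o + x • a + y • b + z • c) = ![w, x, y, z] := by
  obtain rfl : w = 1 - x - y - z := by linarith
  have e1 : vol ((1 - x - y - z) • o + x • a + y • b + z • c - o) (b - o) (c - o) =
      x * vol (a - o) (b - o) (c - o) := by
    simp [vol]; ring
  have e2 : vol (a - o) ((1 - x - y - z) • o + x • a + y • b + z • c - o) (c - o) =
      y * vol (a - o) (b - o) (c - o) := by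
    simp [vol]; ring
  have e3 : vol (a - o) (b - o) ((1 - x - y - z) • o + x • a + y • b + z • c - o) =
      z * vol (a - o) (b - o) (c - o) := by
    simp [vol]; ring
  simp only [tetraCoord, e1, e2, e3, mul_div_cancel_right₀ _ hD]

theorem mem_solidTriangle_iff_zero {o a b c : E3} (hD : vol (a - o) (b - o) (c - o) ≠ 0) (z : E3) :
    z ∈ solidTriangle a b c ↔
      (∀ j, 0 ≤ tetraCoord o a b c z j) ∧ tetraCoord o a b c z 0 = 0 := by
  constructor
  · rintro ⟨α, β, γ, h1, h2, h3, h4, rfl⟩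
    have := tetraCoord_of_combo hD (w := 0) (x := α) (y := β) (z := γ) (by linarith)
    rw [zero_smul, zero_add] at this
    rw [this, Fin.forall_fin_succ, Fin.forall_fin_succ, Fin.forall_fin_succ]
    simp [h1, h2, h3]
  · rintro ⟨h, h0⟩
    refine ⟨_, _, _, h 1, h 2, h 3, by linarith [tetraCoord_sum o a b c z], ?_⟩
    nth_rw 1 [eq_tetraCoord_combo hD z]
    rw [h0]; simp

theorem mem_solidTriangle_iff_one {o a b c : E3} (hD : vol (a - o) (b - o) (c - o) ≠ 0) (z : E3) :
    z ∈ solidTriangle o b c ↔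
      (∀ j, 0 ≤ tetraCoord o a b c z j) ∧ tetraCoord o a b c z 1 = 0 := by
  constructor
  · rintro ⟨α, β, γ, h1, h2, h3, h4, rfl⟩
    have := tetraCoord_of_combo hD (w := α) (x := 0) (y := β) (z := γ) (by linarith)
    rw [zero_smul, add_zero] at this
    rw [this, Fin.forall_fin_succ, Fin.forall_fin_succ, Fin.forall_fin_succ]
    simp [h1, h2, h3]
  · rintro ⟨h, h0⟩
    refine ⟨_, _, _, h 0, h 2, h 3, by linarith [tetraCoord_sum o a b c z], ?_⟩
    nth_rw 1 [eq_tetraCoord_combo hD z]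
    rw [h0]; simp

theorem mem_solidTriangle_iff_two {o a b c : E3} (hD : vol (a - o) (b - o) (c - o) ≠ 0) (z : E3) :
    z ∈ solidTriangle o c a ↔
      (∀ j, 0 ≤ tetraCoord o a b c z j) ∧ tetraCoord o a b c z 2 = 0 := by
  constructor
  · rintro ⟨α, β, γ, h1, h2, h3, h4, rfl⟩
    have := tetraCoord_of_combo hD (w := α) (x := γ) (y := 0) (z := β) (by linarith)
    rw [zero_smul, add_zero, add_right_comm] at this
    rw [this, Fin.forall_fin_succ, Fin.forall_fin_succ, Fin.forall_fin_succ]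
    simp [h1, h2, h3]
  · rintro ⟨h, h0⟩
    refine ⟨_, _, _, h 0, h 3, h 1, by linarith [tetraCoord_sum o a b c z], ?_⟩
    nth_rw 1 [eq_tetraCoord_combo hD z]
    rw [h0, zero_smul]; abel

theorem mem_solidTriangle_iff_three {o a b c : E3} (hD : vol (a - o) (b - o) (c - o) ≠ 0)
    (z : E3) : z ∈ solidTriangle o a b ↔
      (∀ j, 0 ≤ tetraCoord o a b c z j) ∧ tetraCoord o a b c z 3 = 0 := by
  constructor
  · rintro ⟨α, β, γ, h1, h2, h3, h4, rfl⟩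
    have := tetraCoord_of_combo hD (w := α) (x := β) (y := γ) (z := 0) (by linarith)
    rw [zero_smul, add_zero] at this
    rw [this, Fin.forall_fin_succ, Fin.forall_fin_succ, Fin.forall_fin_succ]
    simp [h1, h2, h3]
  · rintro ⟨h, h0⟩
    refine ⟨_, _, _, h 0, h 1, h 2, by linarith [tetraCoord_sum o a b c z], ?_⟩
    nth_rw 1 [eq_tetraCoord_combo hD z]
    rw [h0]; simp

/-- Turns the hitting of a face of the tetrahedron into the root condition of `sum_sign_roots`, with
`h` the barycentric coordinates. -/
theorem hits_iff_of_mem_iff {a b c : E3} {h : E3 → Fin 4 → ℝ} {i : Fin 4}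
    (hm : ∀ z, z ∈ solidTriangle a b c ↔ (∀ j, 0 ≤ h z j) ∧ h z i = 0)
    (haff : ∀ x y t j, h ((1 - t) • x + t • y) j = (1 - t) * h x j + t * h y j) (x y : E3) :
    Hits x y a b c ↔ ∃ t : ℝ, 0 ≤ t ∧ t ≤ 1 ∧ (∀ j, 0 ≤ (1 - t) * h x j + t * h y j) ∧
      (1 - t) * h x i + t * h y i = 0 := by
  constructor
  · rintro ⟨z, hz, hzt⟩
    obtain ⟨t, t0, t1, rfl⟩ := exists_combo_of_mem_segment hz
    rw [hm] at hzt
    simp only [haff] at hzt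
    exact ⟨t, t0, t1, hzt⟩
  · rintro ⟨t, t0, t1, hzt⟩
    refine ⟨_, combo_mem_segment t0 t1, ?_⟩
    rw [hm]
    simpa only [haff] using hzt

/-- The signed intersection numbers of a segment with the faces of a tetrahedron add up to the
difference of the values of a function at its end points. -/
theorem exists_signedHit_tetrahedron {o a b c : E3} (hD : vol (a - o) (b - o) (c - o) ≠ 0) :
    ∃ τ : E3 → ℤ, ∀ (Z : Set E3) (x y : E3), o ∈ Z → a ∈ Z → b ∈ Z → c ∈ Z →
      IsGenericSegment Z x y → signedHit x y a b c =
        signedHit x y o b c + signedHit x y o c a + signedHit x y o a b + (τ y - τ x) := by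
  classical
  set D := vol (a - o) (b - o) (c - o) with hDdef
  set h := tetraCoord o a b c with hh
  -- Up to the orientation sign of the tetrahedron, `τ` is minus the indicator function of the solid
  -- tetrahedron.
  refine ⟨fun z => -(SignType.sign D : ℤ) * (if ∀ j, 0 ≤ h z j then 1 else 0), ?_⟩
  intro Z x y ho ha hb hc hg
  have haff : ∀ x y t j, h ((1 - t) • x + t • y) j = (1 - t) * h x j + t * h y j :=
    fun x y t j => tetraCoord_combo x y t j
  have endp : ∀ z, (∀ u ∈ Z, ∀ v ∈ Z, ∀ w ∈ Z, z ∉ solidTriangle u v w) →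
      (∀ j, 0 ≤ h z j) → ∀ i, h z i ≠ 0 := by
    intro z hz hj i hi
    fin_cases i
    · exact hz a ha b hb c hc ((mem_solidTriangle_iff_zero hD z).2 ⟨hj, hi⟩)
    · exact hz o ho b hb c hc ((mem_solidTriangle_iff_one hD z).2 ⟨hj, hi⟩)
    · exact hz o ho c hc a ha ((mem_solidTriangle_iff_two hD z).2 ⟨hj, hi⟩)
    · exact hz o ho a ha b hb ((mem_solidTriangle_iff_three hD z).2 ⟨hj, hi⟩)
  -- A point of the tetrahedron with two vanishing coordinates lies on one of its edges, which a
  -- generic segment misses. This is the simplicity of roots that `sum_sign_roots` needs.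
  have two : ∀ z ∈ segment ℝ x y, (∀ j, 0 ≤ h z j) →
      ((h z 0 = 0 ∧ h z 1 = 0) ∨ (h z 0 = 0 ∧ h z 2 = 0) ∨ (h z 0 = 0 ∧ h z 3 = 0) ∨
        (h z 1 = 0 ∧ h z 2 = 0) ∨ (h z 1 = 0 ∧ h z 3 = 0) ∨ (h z 2 = 0 ∧ h z 3 = 0)) → False := by
    intro z hz hj hcase
    have e := eq_tetraCoord_combo hD z
    have hs := tetraCoord_sum o a b c z
    rw [← hh] at e hs
    have E : ∀ u ∈ Z, ∀ v ∈ Z, ∀ i j, h z i + h z j = 1 → z = h z i • u + h z j • v → False := by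
      intro u hu v hv i j h1 h2
      exact Set.disjoint_left.mp (hg.disjoint u hu v hv) hz ⟨_, _, hj i, hj j, h1, h2.symm⟩
    rcases hcase with ⟨p, q⟩ | ⟨p, q⟩ | ⟨p, q⟩ | ⟨p, q⟩ | ⟨p, q⟩ | ⟨p, q⟩
    · exact E b hb c hc 2 3 (by linarith) (by rw [p, q] at e; simpa using e)
    · exact E a ha c hc 1 3 (by linarith) (by rw [p, q] at e; simpa using e)
    · exact E a ha b hb 1 2 (by linarith) (by rw [p, q] at e; simpa using e)
    · exact E o ho c hc 0 3 (by linarith) (by rw [p, q] at e; simpa using e)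
    · exact E o ho b hb 0 2 (by linarith) (by rw [p, q] at e; simpa using e)
    · exact E o ho a ha 0 1 (by linarith) (by rw [p, q] at e; simpa using e)
  have main := sum_sign_roots (h x) (h y) (endp x hg.left) (endp y hg.right) (by
    intro t t0 t1 hj i i' hi hi'
    simp only [← haff] at hj hi hi'
    have T := two _ (combo_mem_segment t0 t1) hj
    fin_cases i <;> fin_cases i' <;>
      first | rfl | (exfalso; simp only [Fin.zero_eta, Fin.mk_one, Fin.reduceFinMk] at hi hi'; tauto))
  rw [Fin.sum_univ_four] at main
  have d1 : vol (y - x) (b - o) (c - o) = D * (h y 1 - h x 1) := by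
    have : vol (y - x) (b - o) (c - o) = vol (y - o) (b - o) (c - o) -
      vol (x - o) (b - o) (c - o) := by simp [vol]; ring
    rw [this, hh]; simp only [tetraCoord, ← hDdef, Matrix.cons_val]; field_simp
  have d2 : vol (y - x) (c - o) (a - o) = D * (h y 2 - h x 2) := by
    have : vol (y - x) (c - o) (a - o) = vol (a - o) (y - o) (c - o) -
      vol (a - o) (x - o) (c - o) := by simp [vol]; ring
    rw [this, hh]; simp only [tetraCoord, ← hDdef, Matrix.cons_val]; field_simp
  have d3 : vol (y - x) (a - o) (b - o) = D * (h y 3 - h x 3) := by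
    have : vol (y - x) (a - o) (b - o) = vol (a - o) (b - o) (y - o) -
      vol (a - o) (b - o) (x - o) := by simp [vol]; ring
    rw [this, hh]; simp only [tetraCoord, ← hDdef, Matrix.cons_val]; field_simp
  -- The minus sign appears because the four coordinates always sum to `1`.
  have d0 : vol (y - x) (b - a) (c - a) = -D * (h y 0 - h x 0) := by
    have e : vol (y - x) (b - a) (c - a) = vol (y - x) (b - o) (c - o) +
      vol (y - x) (c - o) (a - o) + vol (y - x) (a - o) (b - o) := by simp [vol]; ring
    have hx := tetraCoord_sum o a b c x
    have hy := tetraCoord_sum o a b c y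
    rw [← hh] at hx hy
    rw [e, d1, d2, d3]
    linear_combination D * (hy - hx)
  have s0 : (SignType.sign (vol (y - x) (b - a) (c - a)) : ℤ) =
      -(SignType.sign D : ℤ) * SignType.sign (h y 0 - h x 0) := by
    rw [d0, sign_mul, Left.sign_neg]; simp
  have s1 : (SignType.sign (vol (y - x) (b - o) (c - o)) : ℤ) =
      (SignType.sign D : ℤ) * SignType.sign (h y 1 - h x 1) := by rw [d1, sign_mul]; simp
  have s2 : (SignType.sign (vol (y - x) (c - o) (a - o)) : ℤ) =
      (SignType.sign D : ℤ) * SignType.sign (h y 2 - h x 2) := by rw [d2, sign_mul]; simp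
  have s3 : (SignType.sign (vol (y - x) (a - o) (b - o)) : ℤ) =
      (SignType.sign D : ℤ) * SignType.sign (h y 3 - h x 3) := by rw [d3, sign_mul]; simp
  have k0 := hits_iff_of_mem_iff (mem_solidTriangle_iff_zero hD) haff x y
  have k1 := hits_iff_of_mem_iff (mem_solidTriangle_iff_one hD) haff x y
  have k2 := hits_iff_of_mem_iff (mem_solidTriangle_iff_two hD) haff x y
  have k3 := hits_iff_of_mem_iff (mem_solidTriangle_iff_three hD) haff x y
  have l0 : signedHit x y a b c = -(SignType.sign D : ℤ) *
      (if ∃ t : ℝ, 0 ≤ t ∧ t ≤ 1 ∧ (∀ j, 0 ≤ (1 - t) * h x j + t * h y j) ∧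
        (1 - t) * h x 0 + t * h y 0 = 0 then (SignType.sign (h y 0 - h x 0) : ℤ) else 0) := by
    rw [mul_ite, ← s0, mul_zero, signedHit]; exact if_congr k0 rfl rfl
  have l1 : signedHit x y o b c = (SignType.sign D : ℤ) *
      (if ∃ t : ℝ, 0 ≤ t ∧ t ≤ 1 ∧ (∀ j, 0 ≤ (1 - t) * h x j + t * h y j) ∧
        (1 - t) * h x 1 + t * h y 1 = 0 then (SignType.sign (h y 1 - h x 1) : ℤ) else 0) := by
    rw [mul_ite, ← s1, mul_zero, signedHit]; exact if_congr k1 rfl rfl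
  have l2 : signedHit x y o c a = (SignType.sign D : ℤ) *
      (if ∃ t : ℝ, 0 ≤ t ∧ t ≤ 1 ∧ (∀ j, 0 ≤ (1 - t) * h x j + t * h y j) ∧
        (1 - t) * h x 2 + t * h y 2 = 0 then (SignType.sign (h y 2 - h x 2) : ℤ) else 0) := by
    rw [mul_ite, ← s2, mul_zero, signedHit]; exact if_congr k2 rfl rfl
  have l3 : signedHit x y o a b = (SignType.sign D : ℤ) *
      (if ∃ t : ℝ, 0 ≤ t ∧ t ≤ 1 ∧ (∀ j, 0 ≤ (1 - t) * h x j + t * h y j) ∧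
        (1 - t) * h x 3 + t * h y 3 = 0 then (SignType.sign (h y 3 - h x 3) : ℤ) else 0) := by
    rw [mul_ite, ← s3, mul_zero, signedHit]; exact if_congr k3 rfl rfl
  rw [l0, l1, l2, l3]
  dsimp only
  linear_combination (-(SignType.sign D : ℤ)) * main

/-! ### General position by small translations -/

/-- Each excluded set is a translate of a subspace of dimension at most two, hence a null set, and
finitely many null sets cannot cover a ball. -/
theorem exists_small_avoiding {ι : Type*} [Finite ι] (b u v : ι → E3) {ε : ℝ} (hε : 0 < ε) :
    ∃ w : E3, ‖w‖ < ε ∧ ∀ k, w - b k ∉ Submodule.span ℝ {u k, v k} := by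
  have hnull : ∀ k, MeasureTheory.volume {w : E3 | w - b k ∈ Submodule.span ℝ {u k, v k}} = 0 := by
    intro k
    have hne : Submodule.span ℝ {u k, v k} ≠ ⊤ := by
      intro h
      have h1 := finrank_span_finset_le_card (R := ℝ) ({u k, v k} : Finset E3)
      have h2 : ({u k, v k} : Finset E3).card ≤ 2 := Finset.card_le_two
      rw [Set.finrank, Finset.coe_insert, Finset.coe_singleton, h, finrank_top] at h1
      simp at h1
      omega
    have := MeasureTheory.Measure.addHaar_submodule MeasureTheory.volume _ hne
    rw [← MeasureTheory.measure_preimage_add_right MeasureTheory.volume (-b k)] at this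
    simpa [Set.preimage, sub_eq_add_neg] using this
  have hU : MeasureTheory.volume (⋃ k, {w : E3 | w - b k ∈ Submodule.span ℝ {u k, v k}}) = 0 :=
    MeasureTheory.measure_iUnion_null hnull
  have hball : MeasureTheory.volume (Metric.ball (0 : E3) ε) ≠ 0 :=
    (Metric.measure_ball_pos _ _ hε).ne'
  have : ¬ Metric.ball (0 : E3) ε ⊆ ⋃ k, {w : E3 | w - b k ∈ Submodule.span ℝ {u k, v k}} :=
    fun h => hball (MeasureTheory.measure_mono_null h hU)
  obtain ⟨w, hw, hw'⟩ := Set.not_subset.mp this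
  refine ⟨w, by simpa using hw, fun k hk => hw' (Set.mem_iUnion.2 ⟨k, hk⟩)⟩

/-- Arbitrarily small translations bring finitely many segments into general position. -/
theorem exists_small_generic {ι : Type*} [Finite ι] (x y : ι → E3) {Z : Set E3} (hZ : Z.Finite)
    {ε : ℝ} (hε : 0 < ε) :
    ∃ w : E3, ‖w‖ < ε ∧ ∀ i, IsGenericSegment Z (x i + w) (y i + w) := by
  have : Finite Z := hZ
  -- The three families forbid, in turn, a translated first end point in the plane of three points
  -- of `Z`, the same for the second end point, and a translated line meeting a line through two
  -- points of `Z`.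
  obtain ⟨w, hw, h⟩ := exists_small_avoiding
    (ι := (ι × Z × Z × Z) ⊕ (ι × Z × Z × Z) ⊕ (ι × Z × Z))
    (Sum.elim (fun q => q.2.1.1 - x q.1) (Sum.elim (fun q => q.2.1.1 - y q.1)
      (fun q => q.2.1.1 - x q.1)))
    (Sum.elim (fun q => q.2.2.1.1 - q.2.1.1) (Sum.elim (fun q => q.2.2.1.1 - q.2.1.1)
      (fun q => q.2.2.1 - q.2.1.1)))
    (Sum.elim (fun q => q.2.2.2.1 - q.2.1.1) (Sum.elim (fun q => q.2.2.2.1 - q.2.1.1)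
      (fun q => y q.1 - x q.1))) hε
  refine ⟨w, hw, fun i => ⟨?_, ?_, ?_⟩⟩
  · rintro a ha b hb c hc ⟨α, β, γ, -, -, -, hs, e⟩
    refine h (Sum.inl (i, ⟨a, ha⟩, ⟨b, hb⟩, ⟨c, hc⟩)) ?_
    refine Submodule.mem_span_pair.2 ⟨β, γ, ?_⟩
    obtain rfl : α = 1 - β - γ := by linarith
    rw [← sub_eq_zero] at e ⊢
    rw [← neg_eq_zero, ← e]
    simp only [Sum.elim_inl]
    module
  · rintro a ha b hb c hc ⟨α, β, γ, -, -, -, hs, e⟩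
    refine h (Sum.inr (Sum.inl (i, ⟨a, ha⟩, ⟨b, hb⟩, ⟨c, hc⟩))) ?_
    refine Submodule.mem_span_pair.2 ⟨β, γ, ?_⟩
    obtain rfl : α = 1 - β - γ := by linarith
    rw [← sub_eq_zero] at e ⊢
    rw [← neg_eq_zero, ← e]
    simp only [Sum.elim_inl, Sum.elim_inr]
    module
  · intro a ha b hb
    rw [Set.disjoint_left]
    intro z hz hz'
    obtain ⟨t, -, -, rfl⟩ := exists_combo_of_mem_segment hz
    obtain ⟨s, -, -, e⟩ := exists_combo_of_mem_segment hz'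
    refine h (Sum.inr (Sum.inr (i, ⟨a, ha⟩, ⟨b, hb⟩))) ?_
    refine Submodule.mem_span_pair.2 ⟨s, -t, ?_⟩
    rw [← sub_eq_zero] at e ⊢
    rw [← neg_eq_zero, ← e]
    simp only [Sum.elim_inr]
    module

/-- In a linear relation among the three vectors `u` must occur, as `v` and `w` are independent. -/
theorem mem_span_of_vol_eq_zero {u v w : E3} (h : vol u v w = 0)
    (hvw : ∀ r s : ℝ, r • v + s • w = 0 → r = 0 ∧ s = 0) : u ∈ Submodule.span ℝ {v, w} := by
  have hdet : Matrix.det (Matrix.of ![![u 0, u 1, u 2], ![v 0, v 1, v 2], ![w 0, w 1, w 2]]) = 0 := by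
    rw [Matrix.det_fin_three]
    simp only [Matrix.of_apply, Matrix.cons_val]
    rw [← h, vol]; ring
  obtain ⟨c, hc, hc0⟩ := Matrix.exists_vecMul_eq_zero_iff.2 hdet
  have e : c 0 • u + c 1 • v + c 2 • w = 0 := by
    ext i
    have := congrFun hc0 i
    rw [Matrix.vecMul, dotProduct, Fin.sum_univ_three] at this
    fin_cases i <;> simpa using this
  have hc00 : c 0 ≠ 0 := by
    intro h0
    rw [h0, zero_smul, zero_add] at e
    obtain ⟨h1, h2⟩ := hvw _ _ e
    apply hc
    ext i
    fin_cases i <;> simp [h0, h1, h2]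
  refine Submodule.mem_span_pair.2 ⟨-(c 1 / c 0), -(c 2 / c 0), ?_⟩
  have : u = (c 0)⁻¹ • (c 0 • u + c 1 • v + c 2 • w) - (c 1 / c 0) • v - (c 2 / c 0) • w := by
    simp only [smul_add, smul_smul, inv_mul_cancel₀ hc00, one_smul]
    rw [div_eq_inv_mul, div_eq_inv_mul]; abel
  rw [this, e]; module

/-! ### Intersections read off from signs of determinants -/

/-- Six times the signed volume of a tetrahedron. -/
def tetraVol (a b c d : E3) : ℝ := vol (b - a) (c - a) (d - a)

/-- The end points must lie on opposite sides of the plane `ocd`, and the line `xy` must pass the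
three sides of the triangle in the same sense. With nonzero determinants these are open conditions.
-/
theorem hits_iff_tetraVol {x y o c d : E3} (hA : tetraVol x o c d ≠ 0) (hB : tetraVol y o c d ≠ 0)
    (h1 : tetraVol x y o c ≠ 0) (h2 : tetraVol x y c d ≠ 0) (h3 : tetraVol x y d o ≠ 0) :
    Hits x y o c d ↔ tetraVol x o c d * tetraVol y o c d < 0 ∧
      0 < tetraVol x y o c * tetraVol x y c d ∧ 0 < tetraVol x y c d * tetraVol x y d o := by
  have hsum : tetraVol x y o c + tetraVol x y c d + tetraVol x y d o =
      tetraVol x o c d - tetraVol y o c d := by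
    simp [tetraVol, vol]; ring
  -- Divided by `A - B`, this relation among five points gives the crossing point both on the line
  -- `xy` and in barycentric coordinates of `ocd`.
  have hrel : tetraVol x o c d • y - tetraVol y o c d • x =
      tetraVol x y c d • o + tetraVol x y d o • c + tetraVol x y o c • d := by
    ext i
    fin_cases i <;> simp [tetraVol, vol] <;> ring
  constructor
  · rintro ⟨z, hz, α, β, γ, a1, a2, a3, a4, hzt⟩
    obtain ⟨t, t0, t1, hzs⟩ := exists_combo_of_mem_segment hz
    have eA : (1 - t) * tetraVol x o c d + t * tetraVol y o c d = 0 := by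
      have e1 : tetraVol z o c d = (1 - t) * tetraVol x o c d + t * tetraVol y o c d := by
        rw [hzs]; simp [tetraVol, vol]; ring
      have e2 : tetraVol z o c d = 0 := by
        obtain rfl : α = 1 - β - γ := by linarith
        rw [hzt]; simp [tetraVol, vol]; ring
      linarith
    have eC : α * tetraVol x y o c = γ * tetraVol x y c d := by
      have e1 : tetraVol x y z c = 0 := by
        rw [hzs]; simp [tetraVol, vol]; ring
      have e2 : tetraVol x y z c = α * tetraVol x y o c - γ * tetraVol x y c d := by
        obtain rfl : α = 1 - β - γ := by linarith
        rw [hzt]; simp [tetraVol, vol]; ring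
      linarith
    have eD : α * tetraVol x y d o = β * tetraVol x y c d := by
      have e1 : tetraVol x y z d = 0 := by
        rw [hzs]; simp [tetraVol, vol]; ring
      have e2 : tetraVol x y z d = β * tetraVol x y c d - α * tetraVol x y d o := by
        obtain rfl : α = 1 - β - γ := by linarith
        rw [hzt]; simp [tetraVol, vol]; ring
      linarith
    have hα : 0 < α := by
      refine lt_of_le_of_ne a1 ?_
      rintro rfl
      have : γ = 0 := by simpa [h2] using eC.symm
      have : β = 0 := by simpa [h2] using eD.symm
      linarith
    refine ⟨?_, ?_, ?_⟩
    · have ht : 0 < t := by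
        refine lt_of_le_of_ne t0 ?_
        rintro rfl
        simp [hA] at eA
      refine lt_of_le_of_ne ?_ (mul_ne_zero hA hB)
      have : t * (tetraVol x o c d * tetraVol y o c d) = -((1 - t) * tetraVol x o c d ^ 2) := by
        linear_combination tetraVol x o c d * eA
      have h5 : 0 ≤ (1 - t) * tetraVol x o c d ^ 2 :=
        mul_nonneg (by linarith) (sq_nonneg _)
      by_contra hcon
      push Not at hcon
      have := mul_pos ht hcon
      linarith
    · refine lt_of_le_of_ne ?_ (mul_ne_zero h1 h2).symm
      have : α * (tetraVol x y o c * tetraVol x y c d) = γ * tetraVol x y c d ^ 2 := by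
        linear_combination tetraVol x y c d * eC
      have h5 : 0 ≤ γ * tetraVol x y c d ^ 2 := mul_nonneg a3 (sq_nonneg _)
      by_contra hcon
      push Not at hcon
      have := mul_neg_of_pos_of_neg hα hcon
      linarith
    · refine lt_of_le_of_ne ?_ (mul_ne_zero h2 h3).symm
      have : α * (tetraVol x y c d * tetraVol x y d o) = β * tetraVol x y c d ^ 2 := by
        linear_combination tetraVol x y c d * eD
      have h5 : 0 ≤ β * tetraVol x y c d ^ 2 := mul_nonneg a2 (sq_nonneg _)
      by_contra hcon
      push Not at hcon
      have := mul_neg_of_pos_of_neg hα hcon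
      linarith
  · rintro ⟨hAB, h12, h23⟩
    set A := tetraVol x o c d
    set B := tetraVol y o c d
    set C₁ := tetraVol x y o c
    set C₂ := tetraVol x y c d
    set C₃ := tetraVol x y d o
    have hne : A - B ≠ 0 := by
      intro h
      have : A = B := by linarith
      rw [this] at hAB
      nlinarith [mul_self_nonneg B]
    have nn : ∀ r : ℝ, 0 ≤ r * (A - B) → 0 ≤ r / (A - B) := by
      intro r hr
      have : r / (A - B) = r * (A - B) / (A - B) ^ 2 := by field_simp
      rw [this]; positivity
    refine ⟨(-B / (A - B)) • x + (A / (A - B)) • y, ⟨-B / (A - B), A / (A - B), ?_, ?_, ?_, rfl⟩,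
      C₂ / (A - B), C₃ / (A - B), C₁ / (A - B), ?_, ?_, ?_, ?_, ?_⟩
    · apply nn; nlinarith [mul_self_nonneg B]
    · apply nn; nlinarith [mul_self_nonneg A]
    · field_simp; ring
    · apply nn; rw [← hsum]; nlinarith [mul_self_nonneg C₂]
    · apply nn; rw [← hsum]
      have : 0 < C₁ * C₃ := by
        have h := mul_pos h12 h23
        have h2' : 0 < C₂ ^ 2 := by positivity
        by_contra hcon
        push Not at hcon
        nlinarith
      nlinarith [mul_self_nonneg C₃]
    · apply nn; rw [← hsum]
      have : 0 < C₁ * C₃ := by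
        have h := mul_pos h12 h23
        have h2' : 0 < C₂ ^ 2 := by positivity
        by_contra hcon
        push Not at hcon
        nlinarith
      nlinarith [mul_self_nonneg C₁]
    · field_simp; linarith
    · have e : (A - B)⁻¹ • (A • y - B • x) = (A - B)⁻¹ • (C₂ • o + C₃ • c + C₁ • d) := by rw [hrel]
      simp only [div_eq_inv_mul]
      rw [smul_sub, smul_add, smul_add, smul_smul, smul_smul, smul_smul, smul_smul, smul_smul] at e
      rw [← e, mul_neg, neg_smul]; abel

-- Only signs of nonvanishing continuous functions enter the right side, so the intersection number
-- is locally constant there.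
open Classical in
theorem signedHit_eq_sign_tetraVol {x y o c d : E3} (hA : tetraVol x o c d ≠ 0)
    (hB : tetraVol y o c d ≠ 0)
    (h1 : tetraVol x y o c ≠ 0) (h2 : tetraVol x y c d ≠ 0) (h3 : tetraVol x y d o ≠ 0) :
    signedHit x y o c d =
      if SignType.sign (tetraVol x o c d) * SignType.sign (tetraVol y o c d) = -1 ∧
        SignType.sign (tetraVol x y o c) * SignType.sign (tetraVol x y c d) = 1 ∧
        SignType.sign (tetraVol x y c d) * SignType.sign (tetraVol x y d o) = 1
      then (SignType.sign (tetraVol x o c d) : ℤ) else 0 := by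
  have e : vol (y - x) (c - o) (d - o) = tetraVol x o c d - tetraVol y o c d := by
    simp [tetraVol, vol]; ring
  rw [signedHit]
  simp only [← sign_mul, sign_eq_one_iff, sign_eq_neg_one_iff]
  have h := hits_iff_tetraVol hA hB h1 h2 h3
  by_cases k : Hits x y o c d
  · rw [if_pos k, if_pos (h.1 k), e]
    have := (h.1 k).1
    rcases lt_or_gt_of_ne hA with g | g
    · have g' : 0 < tetraVol y o c d := by
        by_contra hcon
        push Not at hcon
        nlinarith
      rw [sign_neg g, sign_neg (by linarith)]
    · have g' : tetraVol y o c d < 0 := by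
        by_contra hcon
        push Not at hcon
        nlinarith
      rw [sign_pos g, sign_pos (by linarith)]
  · rw [if_neg k, if_neg (mt h.2 k)]

theorem eventually_sign_eq {X : Type*} [TopologicalSpace X] {f : X → ℝ} (hf : Continuous f) {q : X}
    (hq : f q ≠ 0) : ∀ᶠ q' in nhds q, f q' ≠ 0 ∧ SignType.sign (f q') = SignType.sign (f q) := by
  rcases lt_or_gt_of_ne hq with h | h
  · filter_upwards [hf.continuousAt.eventually_lt continuousAt_const h] with q' hq'
    exact ⟨hq'.ne, by rw [sign_neg hq', sign_neg h]⟩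
  · filter_upwards [continuousAt_const.eventually_lt hf.continuousAt h] with q' hq'
    exact ⟨hq'.ne', by rw [sign_pos hq', sign_pos h]⟩

/-- The signed intersection number does not change under small perturbations of points in general
position. -/
theorem eventually_signedHit_eq {x y o c d : E3} (hA : tetraVol x o c d ≠ 0)
    (hB : tetraVol y o c d ≠ 0)
    (h1 : tetraVol x y o c ≠ 0) (h2 : tetraVol x y c d ≠ 0) (h3 : tetraVol x y d o ≠ 0) :
    ∀ᶠ q : E3 × E3 in nhds (0, o),
      signedHit (x + q.1) (y + q.1) q.2 c d = signedHit x y o c d := by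
  have cA : Continuous fun q : E3 × E3 => tetraVol (x + q.1) q.2 c d := by
    unfold tetraVol vol; fun_prop
  have cB : Continuous fun q : E3 × E3 => tetraVol (y + q.1) q.2 c d := by
    unfold tetraVol vol; fun_prop
  have c1 : Continuous fun q : E3 × E3 => tetraVol (x + q.1) (y + q.1) q.2 c := by
    unfold tetraVol vol; fun_prop
  have c2 : Continuous fun q : E3 × E3 => tetraVol (x + q.1) (y + q.1) c d := by
    unfold tetraVol vol; fun_prop
  have c3 : Continuous fun q : E3 × E3 => tetraVol (x + q.1) (y + q.1) d q.2 := by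
    unfold tetraVol vol; fun_prop
  filter_upwards [eventually_sign_eq cA (q := (0, o)) (by simpa using hA),
    eventually_sign_eq cB (q := (0, o)) (by simpa using hB),
    eventually_sign_eq c1 (q := (0, o)) (by simpa using h1),
    eventually_sign_eq c2 (q := (0, o)) (by simpa using h2),
    eventually_sign_eq c3 (q := (0, o)) (by simpa using h3)] with q eA eB e1 e2 e3
  rw [signedHit_eq_sign_tetraVol eA.1 eB.1 e1.1 e2.1 e3.1,
    signedHit_eq_sign_tetraVol hA hB h1 h2 h3, eA.2, eB.2, e1.2, e2.2, e3.2]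
  simp only [add_zero]

/-! ### Polygons inscribed in the moment curve -/

/-- The moment curve. -/
noncomputable def momentCurve (t : ℝ) : E3 := !₂[t, t ^ 2, t ^ 3]

/-- A Vandermonde determinant. -/
theorem tetraVol_momentCurve (a b c d : ℝ) :
    tetraVol (momentCurve a) (momentCurve b) (momentCurve c) (momentCurve d) =
      (b - a) * (c - a) * (d - a) * (c - b) * (d - b) * (d - c) := by
  simp [tetraVol, vol, momentCurve]; ring

theorem tetraVol_momentCurve_ne_zero {a b c d : ℝ} (hab : a ≠ b) (hac : a ≠ c) (had : a ≠ d)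
    (hbc : b ≠ c) (hbd : b ≠ d) (hcd : c ≠ d) :
    tetraVol (momentCurve a) (momentCurve b) (momentCurve c) (momentCurve d) ≠ 0 := by
  rw [tetraVol_momentCurve]
  simp only [ne_eq, mul_eq_zero, sub_eq_zero]
  tauto

/-- The Radon partition of five points on the moment curve separates the odd from the even
positions. As `o` comes first, the segment crosses the triangle only in the order `o < a < c < b <
d`. -/
theorem signedHit_momentCurve {o a b c d : ℝ} (hoa : o < a) (hob : o < b) (hoc : o < c)
    (hod : o < d) (hab : a < b) (hcd : c < d) (hac : a ≠ c) (had : a ≠ d) (hbc : b ≠ c)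
    (hbd : b ≠ d) [Decidable (a < c ∧ c < b ∧ b < d)] :
    signedHit (momentCurve a) (momentCurve b) (momentCurve o) (momentCurve c) (momentCurve d) =
      if a < c ∧ c < b ∧ b < d then -1 else 0 := by
  rw [signedHit_eq_sign_tetraVol
    (tetraVol_momentCurve_ne_zero hoa.ne' hac had hoc.ne hod.ne hcd.ne)
    (tetraVol_momentCurve_ne_zero hob.ne' hbc hbd hoc.ne hod.ne hcd.ne)
    (tetraVol_momentCurve_ne_zero hab.ne hoa.ne' hac hob.ne' hbc hoc.ne)
    (tetraVol_momentCurve_ne_zero hab.ne hac had hbc hbd hcd.ne)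
    (tetraVol_momentCurve_ne_zero hab.ne had hoa.ne' hbd hob.ne' hod.ne')]
  simp only [tetraVol_momentCurve, sign_mul, sign_neg (sub_neg.2 hoa), sign_neg (sub_neg.2 hob),
    sign_pos (sub_pos.2 hoc), sign_pos (sub_pos.2 hod), sign_pos (sub_pos.2 hab),
    sign_pos (sub_pos.2 hcd), sign_neg (sub_neg.2 hod)]
  rcases lt_or_gt_of_ne hac with h1 | h1 <;> rcases lt_or_gt_of_ne had with h2 | h2 <;>
    rcases lt_or_gt_of_ne hbc with h3 | h3 <;> rcases lt_or_gt_of_ne hbd with h4 | h4 <;>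
    simp [h1, h2, h3, h4, h1.not_gt, h3.not_gt, h4.not_gt, sign_pos, sign_neg] <;>
    linarith

theorem disjoint_segment_of_tetraVol_ne_zero {a b c d : E3} (h : tetraVol a b c d ≠ 0) :
    Disjoint (segment ℝ a b) (segment ℝ c d) := by
  rw [Set.disjoint_left]
  intro z hz hz'
  obtain ⟨t, t0, t1, hzt⟩ := exists_combo_of_mem_segment hz
  obtain ⟨s, s0, s1, hzs⟩ := exists_combo_of_mem_segment hz'
  have e1 : tetraVol a b c z = s * tetraVol a b c d := by
    rw [hzs]; simp [tetraVol, vol]; ring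
  have e2 : tetraVol a b c z = 0 := by
    rw [hzt]; simp [tetraVol, vol]; ring
  have e3 : tetraVol a b z d = (1 - s) * tetraVol a b c d := by
    rw [hzs]; simp [tetraVol, vol]; ring
  have e4 : tetraVol a b z d = 0 := by
    rw [hzt]; simp [tetraVol, vol]; ring
  have h1 : s = 0 := by simpa [h] using e1.symm.trans e2
  have h2 : 1 - s = 0 := by simpa [h] using e3.symm.trans e4
  linarith

theorem not_collinear_momentCurve {a b c : ℝ} (hab : a ≠ b) (hac : a ≠ c) (hbc : b ≠ c) :
    ¬ Collinear ℝ {momentCurve a, momentCurve b, momentCurve c} := by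
  intro h
  rw [collinear_iff_of_mem (p₀ := momentCurve a) (by simp)] at h
  obtain ⟨v, hv⟩ := h
  obtain ⟨r, hr⟩ := hv (momentCurve b) (by simp)
  obtain ⟨s, hs⟩ := hv (momentCurve c) (by simp)
  have r0 := congrArg (fun z : E3 => z 0) hr
  have r1 := congrArg (fun z : E3 => z 1) hr
  have s0 := congrArg (fun z : E3 => z 0) hs
  have s1 := congrArg (fun z : E3 => z 1) hs
  simp [momentCurve] at r0 r1 s0 s1
  have : (b - a) * (c - a) * (c - b) = 0 := by
    have e : (b - a) * (c ^ 2 - a ^ 2) = (c - a) * (b ^ 2 - a ^ 2) := by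
      have e1 : b - a = r * v 0 := by linarith
      have e2 : c - a = s * v 0 := by linarith
      have e3 : b ^ 2 - a ^ 2 = r * v 1 := by linarith
      have e4 : c ^ 2 - a ^ 2 = s * v 1 := by linarith
      rw [e1, e2, e3, e4]; ring
    linear_combination e
  simp only [mul_eq_zero, sub_eq_zero] at this
  rcases this with (h | h) | h
  · exact hab h.symm
  · exact hac h.symm
  · exact hbc h.symm

theorem segment_inter_momentCurve {a b c : ℝ} (hac : a ≠ c) (hbc : b ≠ c) :
    segment ℝ (momentCurve a) (momentCurve b) ∩ segment ℝ (momentCurve b) (momentCurve c) =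
      {momentCurve b} := by
  apply Set.Subset.antisymm
  · rintro z ⟨hz, hz'⟩
    obtain ⟨t, t0, t1, hzt⟩ := exists_combo_of_mem_segment hz
    obtain ⟨s, s0, s1, hzs⟩ := exists_combo_of_mem_segment hz'
    have h0 := congrArg (fun z : E3 => z 0) (hzt.symm.trans hzs)
    have h1 := congrArg (fun z : E3 => z 1) (hzt.symm.trans hzs)
    simp [momentCurve] at h0 h1
    have : s * ((c - b) * (c - a)) = 0 := by linear_combination (a + b) * h0 - h1
    have hs : s = 0 := by
      simp only [mul_eq_zero, sub_eq_zero] at this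
      rcases this with h | h | h
      · exact h
      · exact absurd h.symm hbc
      · exact absurd h.symm hac
    simp [hzs, hs]
  · rintro z rfl
    exact ⟨right_mem_segment ℝ _ _, left_mem_segment ℝ _ _⟩

theorem val_finRotate {n : ℕ} (i : Fin n) :
    (finRotate n i : ℕ) = if (i : ℕ) + 1 = n then 0 else (i : ℕ) + 1 := by
  obtain ⟨m, rfl⟩ : ∃ m, n = m + 1 := ⟨n - 1, by have := i.2; omega⟩
  rw [coe_finRotate]
  simp [Fin.ext_iff]

theorem finRotate_ne_self {n : ℕ} (hn : 3 ≤ n) (i : Fin n) : finRotate n i ≠ i := by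
  intro h
  have := congrArg Fin.val h
  rw [val_finRotate] at this
  split_ifs at this <;> omega

theorem finRotate_finRotate_ne_self {n : ℕ} (hn : 3 ≤ n) (i : Fin n) :
    finRotate n (finRotate n i) ≠ i := by
  intro h
  have := congrArg Fin.val h
  rw [val_finRotate, val_finRotate] at this
  have := i.2
  split_ifs at * <;> omega

theorem edgeSet_eq_segment {n : ℕ} (P : Polygon E3 n) (i : Fin n) :
    P.edgeSet ℝ i = segment ℝ (P i) (P (finRotate n i)) :=
  affineSegment_eq_segment ℝ _ _

theorem isEmbeddedPolygon_momentCurve {n : ℕ} (hn : 3 ≤ n) {t : Fin n → ℝ}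
    (ht : Function.Injective t) :
    IsEmbeddedPolygon (⟨fun i => momentCurve (t i)⟩ : Polygon E3 n) where
  three_le := hn
  not_collinear i := not_collinear_momentCurve (ht.ne (finRotate_ne_self hn i).symm)
    (ht.ne (finRotate_finRotate_ne_self hn i).symm) (ht.ne (finRotate_ne_self hn _).symm)
  consecutive i := by
    rw [edgeSet_eq_segment, edgeSet_eq_segment]
    exact segment_inter_momentCurve (ht.ne (finRotate_finRotate_ne_self hn i).symm) (ht.ne (finRotate_ne_self hn _).symm)
  disjoint i j hij hj hi := by
    rw [edgeSet_eq_segment, edgeSet_eq_segment]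
    exact disjoint_segment_of_tetraVol_ne_zero (tetraVol_momentCurve_ne_zero
      (ht.ne (finRotate_ne_self hn i).symm) (ht.ne hij) (ht.ne hi) (ht.ne hj.symm)
      (ht.ne ((finRotate n).injective.ne hij)) (ht.ne (finRotate_ne_self hn j).symm))

/-! ### Counting interleaving edges -/

/-- `1` if the intervals `[a, b]` and `[c, d]` interleave, with `[a, b]` to the left. -/
def interleaving (a b c d : ℕ) : ℤ := if a < c ∧ c < b ∧ b < d then 1 else 0

/-- The signed version of `interleaving` for intervals with arbitrary directions. -/
def signedInterleaving (a b c d : ℕ) : ℤ :=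
  if a < b then (if c < d then interleaving a b c d else -interleaving a b d c)
  else (if c < d then -interleaving b a c d else interleaving b a d c)

theorem signedHit_momentCurve_nat {a b c d : ℕ} (hab : a ≠ b) (hcd : c ≠ d) (hac : a ≠ c)
    (had : a ≠ d) (hbc : b ≠ c) (hbd : b ≠ d) :
    signedHit (momentCurve a) (momentCurve b) (momentCurve (-1)) (momentCurve c) (momentCurve d) =
      -signedInterleaving a b c d := by
  have key : ∀ {a b c d : ℕ}, a < b → c < d → a ≠ c → a ≠ d → b ≠ c → b ≠ d →
      signedHit (momentCurve a) (momentCurve b) (momentCurve (-1)) (momentCurve c)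
        (momentCurve d) = -interleaving a b c d := by
    intro a b c d hab hcd hac had hbc hbd
    have pos : ∀ m : ℕ, (-1 : ℝ) < m := fun m => by
      have : (0 : ℝ) ≤ m := m.cast_nonneg
      linarith
    rw [signedHit_momentCurve (pos a) (pos b) (pos c) (pos d) (by exact_mod_cast hab)
      (by exact_mod_cast hcd) (by exact_mod_cast hac) (by exact_mod_cast had)
      (by exact_mod_cast hbc) (by exact_mod_cast hbd)]
    simp only [Nat.cast_lt, interleaving]
    split_ifs <;> rfl
  unfold signedInterleaving
  split_ifs with h1 h2 h2
  · exact key h1 h2 hac had hbc hbd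
  · rw [← neg_eq_iff_eq_neg.2 (signedHit_antisymm _ _ _ _ _),
      key h1 (by omega) had hac hbd hbc]
  · rw [← neg_eq_iff_eq_neg.2 (signedHit_segment_swap _ _ _ _ _),
      key (by omega) h2 hbc hbd hac had]
  · rw [← neg_eq_iff_eq_neg.2 (signedHit_segment_swap _ _ _ _ _),
      ← neg_eq_iff_eq_neg.2 (signedHit_antisymm _ _ _ _ _),
      key (by omega) (by omega) hbd hbc had hac]
    simp

theorem abs_signedInterleaving_le_one (a b c d : ℕ) : |signedInterleaving a b c d| ≤ 1 := by
  unfold signedInterleaving interleaving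
  split_ifs <;> simp

/-- Equal or adjacent edges, for which the determinants vanish, thus add nothing to the
combinatorial sum. -/
theorem signedInterleaving_eq_zero {a b c d : ℕ} (h : a = c ∨ a = d ∨ b = c ∨ b = d) :
    signedInterleaving a b c d = 0 := by
  have e : ∀ {a b c d : ℕ}, (a = c ∨ a = d ∨ b = c ∨ b = d) → c < d → interleaving a b c d = 0 :=
    fun h h' => if_neg (by omega)
  by_cases hcd : c = d
  · subst hcd
    have e : ∀ a b, interleaving a b c c = 0 := fun a b => if_neg (by omega)
    simp [signedInterleaving, e]
  unfold signedInterleaving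
  split_ifs with h1 h2 h2
  · exact e h h2
  · rw [e (by tauto) (by omega), neg_zero]
  · rw [e (by tauto) h2, neg_zero]
  · exact e (by tauto) (by omega)

/-- The parameter on the moment curve of the `m`-th vertex of the polygon with `3 * k` vertices. -/
def vertexParam (k m : ℕ) : ℕ := m % 3 * k + m / 3

/-- The parameter of the vertex following the `m`-th one. -/
def nextParam (k m : ℕ) : ℕ := if m + 1 = 3 * k then 0 else vertexParam k (m + 1)

theorem vertexParam_injective {k m m' : ℕ} (hm : m < 3 * k) (hm' : m' < 3 * k)
    (h : vertexParam k m = vertexParam k m') : m = m' := by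
  unfold vertexParam at h
  have h1 : m / 3 < k := by omega
  have h2 : m' / 3 < k := by omega
  have h3 : m % 3 < 3 := by omega
  have h4 : m' % 3 < 3 := by omega
  generalize hq : m / 3 = q at *
  generalize hq' : m' / 3 = q' at *
  generalize hr : m % 3 = r at *
  generalize hr' : m' % 3 = r' at *
  interval_cases r <;> interval_cases r' <;> omega

theorem sum_range_three_mul {M : Type*} [AddCommMonoid M] (f : ℕ → M) (k : ℕ) :
    ∑ m ∈ Finset.range (3 * k), f m =
      ∑ i ∈ Finset.range k, (f (3 * i) + f (3 * i + 1) + f (3 * i + 2)) := by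
  induction k with
  | zero => simp
  | succ k ih =>
    rw [Finset.sum_range_succ, ← ih, Nat.mul_succ, Finset.sum_range_succ, Finset.sum_range_succ,
      Finset.sum_range_succ]
    simp only [add_assoc]

/-- The interleaving number of the `m`-th and the `m'`-th edge. -/
def edgeInterleaving (k m m' : ℕ) : ℤ :=
  signedInterleaving (vertexParam k m) (nextParam k m) (vertexParam k m') (nextParam k m')

theorem abs_edgeInterleaving_le_one (k m m' : ℕ) : |edgeInterleaving k m m'| ≤ 1 :=
  abs_signedInterleaving_le_one _ _ _ _

/-- The edges of block `i` run through the parameters `i`, `k + i`, `2 * k + i`, `i + 1`. For `i <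
j` three of the nine terms are `1` and two are `-1`; for `j < i` only the pair `3 * i`, `3 * j + 1`
contributes, with `1`; for `i = j` only the pair `3 * i`, `3 * i + 2`, with `-1`. The last block is
excluded because its final edge returns to `0`. -/
theorem edgeInterleaving_block {k i j : ℕ} (hi : i + 1 < k) (hj : j + 1 < k) :
    (if i = j then -1 else 1) ≤
      edgeInterleaving k (3 * i) (3 * j) + edgeInterleaving k (3 * i) (3 * j + 1) +
        edgeInterleaving k (3 * i) (3 * j + 2) +
      (edgeInterleaving k (3 * i + 1) (3 * j) + edgeInterleaving k (3 * i + 1) (3 * j + 1) +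
        edgeInterleaving k (3 * i + 1) (3 * j + 2)) +
      (edgeInterleaving k (3 * i + 2) (3 * j) + edgeInterleaving k (3 * i + 2) (3 * j + 1) +
        edgeInterleaving k (3 * i + 2) (3 * j + 2)) := by
  have v0 : ∀ i, vertexParam k (3 * i) = i := fun i => by
    have h1 : 3 * i % 3 = 0 := by omega
    have h2 : 3 * i / 3 = i := by omega
    rw [vertexParam, h1, h2, zero_mul, zero_add]
  have v1 : ∀ i, vertexParam k (3 * i + 1) = k + i := fun i => by
    have h1 : (3 * i + 1) % 3 = 1 := by omega
    have h2 : (3 * i + 1) / 3 = i := by omega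
    rw [vertexParam, h1, h2, one_mul]
  have v2 : ∀ i, vertexParam k (3 * i + 2) = 2 * k + i := fun i => by
    have h1 : (3 * i + 2) % 3 = 2 := by omega
    have h2 : (3 * i + 2) / 3 = i := by omega
    rw [vertexParam, h1, h2]
  have n0 : ∀ i, i + 1 < k → nextParam k (3 * i) = k + i := fun i h => by
    rw [nextParam, if_neg (by omega), v1]
  have n1 : ∀ i, i + 1 < k → nextParam k (3 * i + 1) = 2 * k + i := fun i h => by
    rw [nextParam, if_neg (by omega), v2]
  have n2 : ∀ i, i + 1 < k → nextParam k (3 * i + 2) = i + 1 := fun i h => by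
    rw [nextParam, if_neg (by omega), show 3 * i + 2 + 1 = 3 * (i + 1) by ring, v0]
  have uu : ∀ {a b c d : ℕ}, a < b → c < d →
      signedInterleaving a b c d = interleaving a b c d := fun h h' => by
    rw [signedInterleaving, if_pos h, if_pos h']
  have ud : ∀ {a b c d : ℕ}, a < b → d < c →
      signedInterleaving a b c d = -interleaving a b d c := fun h h' => by
    rw [signedInterleaving, if_pos h, if_neg (by omega)]
  have du : ∀ {a b c d : ℕ}, b < a → c < d →
      signedInterleaving a b c d = -interleaving b a c d := fun h h' => by
    rw [signedInterleaving, if_neg (by omega), if_pos h']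
  have dd : ∀ {a b c d : ℕ}, b < a → d < c →
      signedInterleaving a b c d = interleaving b a d c := fun h h' => by
    rw [signedInterleaving, if_neg (by omega), if_neg (by omega)]
  simp only [edgeInterleaving, v0, v1, v2, n0 i hi, n1 i hi, n2 i hi, n0 j hj, n1 j hj, n2 j hj]
  rw [uu (by omega) (by omega), uu (by omega) (by omega), ud (by omega) (by omega),
    uu (by omega) (by omega), uu (by omega) (by omega), ud (by omega) (by omega),
    du (by omega) (by omega), du (by omega) (by omega), dd (by omega) (by omega)]
  have T : ∀ {a b c d : ℕ}, (a < c ∧ c < b ∧ b < d) → interleaving a b c d = 1 := fun h => if_pos h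
  have F : ∀ {a b c d : ℕ}, ¬ (a < c ∧ c < b ∧ b < d) → interleaving a b c d = 0 :=
    fun h => if_neg h
  rcases lt_trichotomy i j with h | h | h
  · rw [if_neg (by omega), T (by omega), F (by omega), T (by omega), F (by omega), T (by omega),
      F (by omega), F (by omega), T (by omega), T (by omega)]
    norm_num
  · rw [if_pos h, F (by omega), F (by omega), T (by omega), F (by omega), F (by omega),
      F (by omega), F (by omega), F (by omega), F (by omega)]
    norm_num
  · rw [if_neg (by omega), F (by omega), T (by omega), F (by omega), F (by omega), F (by omega),
      F (by omega), F (by omega), F (by omega), F (by omega)]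
    norm_num

/-- Start from `1` for each of the `k ^ 2` pairs of blocks. A diagonal pair loses `2`. A pair
involving the last block has only the trivial bound `-9`, hence loses `10`, over one row and one
column. Altogether `2 * k + 10 * k + 10 * k`. -/
theorem le_sum_edgeInterleaving (k : ℕ) :
    (k : ℤ) ^ 2 - 22 * k ≤ ∑ m ∈ Finset.range (3 * k), ∑ m' ∈ Finset.range (3 * k),
      edgeInterleaving k m m' := by
  have hl : ∀ m m', -1 ≤ edgeInterleaving k m m' :=
    fun m m' => (abs_le.1 (abs_edgeInterleaving_le_one k m m')).1
  simp only [sum_range_three_mul, ← Finset.sum_add_distrib]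
  have hd : ∀ i ∈ Finset.range k, ∑ j ∈ Finset.range k, (1 - (2 * (if i = j then 1 else 0) +
      10 * (if i + 1 = k then 1 else 0) + 10 * (if j + 1 = k then 1 else 0)) : ℤ) ≥
      k - 12 - 10 * k * (if i + 1 = k then 1 else 0) := by
    intro i hi
    simp only [Finset.sum_sub_distrib, Finset.sum_add_distrib, ← Finset.mul_sum]
    have h1 : ∑ j ∈ Finset.range k, (if j + 1 = k then 1 else 0 : ℤ) ≤ 1 := by
      rw [Finset.sum_boole]
      have : #{j ∈ Finset.range k | j + 1 = k} ≤ 1 := by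
        rw [Finset.card_le_one]
        simp only [Finset.mem_filter]
        omega
      exact_mod_cast this
    have h2 : ∑ j ∈ Finset.range k, (if i = j then 1 else 0 : ℤ) = 1 := by
      rw [Finset.sum_ite_eq]; simp [Finset.mem_range.1 hi]
    rw [h2]
    simp only [Finset.sum_const, Finset.card_range, nsmul_eq_mul, mul_one]
    linarith
  have hsum : (k : ℤ) ^ 2 - 22 * k ≤ ∑ i ∈ Finset.range k,
      ((k : ℤ) - 12 - 10 * k * (if i + 1 = k then 1 else 0)) := by
    simp only [Finset.sum_sub_distrib, ← Finset.mul_sum]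
    have h1 : ∑ j ∈ Finset.range k, (if j + 1 = k then 1 else 0 : ℤ) ≤ 1 := by
      rw [Finset.sum_boole]
      have : #{j ∈ Finset.range k | j + 1 = k} ≤ 1 := by
        rw [Finset.card_le_one]
        simp only [Finset.mem_filter]
        omega
      exact_mod_cast this
    simp only [Finset.sum_const, Finset.card_range, nsmul_eq_mul]
    nlinarith
  refine hsum.trans (Finset.sum_le_sum fun i hi => (hd i hi).le.trans ?_)
  refine Finset.sum_le_sum fun j hj => ?_
  rw [Finset.mem_range] at hi hj
  by_cases h : i + 1 < k ∧ j + 1 < k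
  · have := edgeInterleaving_block h.1 h.2
    rw [if_neg (by omega : ¬ i + 1 = k), if_neg (by omega : ¬ j + 1 = k)]
    split_ifs at * <;> linarith
  · have h1 : (10 : ℤ) ≤ 10 * (if i + 1 = k then 1 else 0) + 10 * (if j + 1 = k then 1 else 0) := by
      split_ifs <;> omega
    have h2 : (0 : ℤ) ≤ if i = j then 1 else 0 := by split_ifs <;> norm_num
    linarith [hl (3 * i) (3 * j), hl (3 * i) (3 * j + 1), hl (3 * i) (3 * j + 2),
      hl (3 * i + 1) (3 * j), hl (3 * i + 1) (3 * j + 1), hl (3 * i + 1) (3 * j + 2),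
      hl (3 * i + 2) (3 * j), hl (3 * i + 2) (3 * j + 1), hl (3 * i + 2) (3 * j + 2)]

/-- The linking number of a polygon `P` with its translate by `w`, counted with a cone over `P`
of apex `o`. -/
noncomputable def coneLinking {n : ℕ} (P : Polygon E3 n) (w o : E3) : ℤ :=
  ∑ i, ∑ j, signedHit (P i + w) (P (finRotate n i) + w) o (P j) (P (finRotate n j))

/-- The bound holds for all nearby translations and apices because both are later perturbed in a way
that depends on the surface. Stability fails for equal or adjacent edges, but there are at most `9 *
k` such ordered pairs, each contributing at most `1`. -/
theorem exists_polygon_coneLinking {k : ℕ} (hk : 124 ≤ k) :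
    ∃ P : Polygon E3 (3 * k), IsEmbeddedPolygon P ∧ ∃ o : E3,
      ∀ᶠ q in nhds ((0 : E3), o), 3 * (k : ℤ) ^ 2 ≤ 4 * |coneLinking P q.1 q.2| := by
  have hn : 3 ≤ 3 * k := by omega
  set t : Fin (3 * k) → ℕ := fun m => vertexParam k m with htdef
  have ht : Function.Injective t := fun m m' h => Fin.ext (vertexParam_injective m.2 m'.2 h)
  have htR : Function.Injective fun m => (t m : ℝ) := Nat.cast_injective.comp ht
  have hnext : ∀ m, t (finRotate _ m) = nextParam k m := by
    intro m
    rw [htdef]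
    simp only [val_finRotate, nextParam]
    split_ifs
    · simp [vertexParam]
    · rfl
  set P : Polygon E3 (3 * k) := ⟨fun i => momentCurve (t i)⟩ with hP
  have hPi : ∀ i, P i = momentCurve (t i) := fun i => rfl
  refine ⟨P, isEmbeddedPolygon_momentCurve hn htR, momentCurve (-1), ?_⟩
  set r := finRotate (3 * k) with hr
  have hrn : ∀ i, r i ≠ i := finRotate_ne_self hn
  have pos : ∀ m : ℕ, (-1 : ℝ) ≠ m := fun m => by
    have : (0 : ℝ) ≤ m := m.cast_nonneg
    linarith
  have hev : ∀ᶠ q in nhds ((0 : E3), momentCurve (-1)), ∀ i j, i ≠ j → j ≠ r i → i ≠ r j →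
      signedHit (P i + q.1) (P (r i) + q.1) q.2 (P j) (P (r j)) = -edgeInterleaving k i j := by
    rw [Filter.eventually_all]; intro i
    rw [Filter.eventually_all]; intro j
    rw [Filter.eventually_imp_distrib_left]; intro h1
    rw [Filter.eventually_imp_distrib_left]; intro h2
    rw [Filter.eventually_imp_distrib_left]; intro h3
    have a1 := ht.ne (hrn i).symm
    have a2 := ht.ne (hrn j).symm
    have a3 := ht.ne h1
    have a4 := ht.ne h3
    have a5 := ht.ne h2.symm
    have a6 := ht.ne (r.injective.ne h1)
    have e := signedHit_momentCurve_nat a1 a2 a3 a4 a5 a6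
    have c : ∀ {p q : ℕ}, p ≠ q → (p : ℝ) ≠ q := fun h => by exact_mod_cast h
    filter_upwards [eventually_signedHit_eq
      (tetraVol_momentCurve_ne_zero (pos _).symm (c a3) (c a4) (pos _) (pos _) (c a2))
      (tetraVol_momentCurve_ne_zero (pos _).symm (c a5) (c a6) (pos _) (pos _) (c a2))
      (tetraVol_momentCurve_ne_zero (c a1) (pos _).symm (c a3) (pos _).symm (c a5) (pos _))
      (tetraVol_momentCurve_ne_zero (c a1) (c a3) (c a4) (c a5) (c a6) (c a2))
      (tetraVol_momentCurve_ne_zero (c a1) (c a4) (pos _).symm (c a6) (pos _).symm (pos _).symm)]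
      with q hq
    rw [hPi, hPi, hPi, hPi, hq, e, edgeInterleaving, ← hnext i, ← hnext j]
  filter_upwards [hev] with q hq
  have hterm : ∀ i j, signedHit (P i + q.1) (P (r i) + q.1) q.2 (P j) (P (r j)) ≤
      -edgeInterleaving k i j + ((if i = j then 1 else 0) + (if j = r i then 1 else 0) +
        (if i = r j then 1 else 0)) := by
    intro i j
    by_cases h : i ≠ j ∧ j ≠ r i ∧ i ≠ r j
    · rw [hq i j h.1 h.2.1 h.2.2, if_neg h.1, if_neg h.2.1, if_neg h.2.2]; simp
    · have h0 : edgeInterleaving k i j = 0 := by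
        rw [edgeInterleaving, ← hnext i, ← hnext j]
        apply signedInterleaving_eq_zero
        by_cases h1 : i = j
        · left; rw [h1]
        by_cases h2 : j = r i
        · right; right; left; exact congrArg t h2.symm
        have h3 : i = r j := by tauto
        right; left; exact congrArg t h3
      have h1 : (1 : ℤ) ≤ (if i = j then 1 else 0) + (if j = r i then 1 else 0) +
        (if i = r j then 1 else 0) := by
        split_ifs <;> omega
      have h2 := (abs_le.1 (abs_signedHit_le_one (P i + q.1) (P (r i) + q.1) q.2 (P j)
        (P (r j)))).2
      linarith
  have hle : coneLinking P q.1 q.2 ≤ -((k : ℤ) ^ 2 - 22 * k) + 9 * k := by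
    calc coneLinking P q.1 q.2 ≤ ∑ i : Fin (3 * k), ∑ j : Fin (3 * k), (-edgeInterleaving k i j + ((if i = j then 1 else 0) +
          (if j = r i then 1 else 0) + (if i = r j then 1 else 0))) :=
          Finset.sum_le_sum fun i _ => Finset.sum_le_sum fun j _ => hterm i j
      _ = -(∑ i : Fin (3 * k), ∑ j : Fin (3 * k), edgeInterleaving k i j) + 9 * k := by
          have e3 : ∑ i, ∑ j, (if i = r j then 1 else 0 : ℤ) = 3 * k := by
            rw [Finset.sum_comm]; simp
          simp only [Finset.sum_add_distrib, Finset.sum_neg_distrib, e3, Finset.sum_ite_eq,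
            Finset.sum_ite_eq', Finset.mem_univ, if_true, Finset.sum_const, Finset.card_univ,
            Fintype.card_fin, nsmul_eq_mul]
          push_cast
          ring
      _ ≤ _ := by
          have := le_sum_edgeInterleaving k
          have e : ∑ i : Fin (3 * k), ∑ j : Fin (3 * k), edgeInterleaving k i j =
              ∑ m ∈ Finset.range (3 * k), ∑ m' ∈ Finset.range (3 * k), edgeInterleaving k m m' := by
            rw [← Fin.sum_univ_eq_sum_range (fun m => ∑ m' ∈ Finset.range (3 * k),
              edgeInterleaving k m m')]
            refine Finset.sum_congr rfl fun i _ => ?_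
            rw [← Fin.sum_univ_eq_sum_range (fun m' => edgeInterleaving k i m')]
          rw [e]
          linarith
  -- The threshold makes `k ^ 2 - 31 * k` at least `3 * k ^ 2 / 4`, where `31 = 22 + 9`.
  have hk' : (124 : ℤ) ≤ k := by exact_mod_cast hk
  have := neg_abs_le (coneLinking P q.1 q.2)
  nlinarith

/-! ### The oriented surface as a chain and its boundary -/

namespace TriangulatedSurface

variable {V : Type*} [Fintype V] [DecidableEq V] (S : TriangulatedSurface V)

theorem ne_of_mem_triangles {a b c : V} (h : {a, b, c} ∈ S.triangles) : a ≠ b ∧ a ≠ c ∧ b ≠ c := by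
  have := S.card_eq_three _ h
  refine ⟨?_, ?_, ?_⟩ <;> rintro rfl
  · have := Finset.card_le_two (a := a) (b := c)
    simp_all
  · have := Finset.card_le_two (a := a) (b := b)
    have e : ({a, b, a} : Finset V) = {a, b} := by ext; simp; tauto
    rw [S.card_eq_three _ (e ▸ h)] at this
    omega
  · have := Finset.card_le_two (a := a) (b := b)
    simp_all

open Classical in
/-- The ordered triples of vertices spanning a triangle, in the positive cyclic order. -/
noncomputable def orientedTriangles (O : V → V → V → Prop) : Finset (V × V × V) :=
  {q | {q.1, q.2.1, q.2.2} ∈ S.triangles ∧ O q.1 q.2.1 q.2.2}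

variable {S} {O : V → V → V → Prop}

theorem mem_orientedTriangles {a b c : V} :
    (a, b, c) ∈ S.orientedTriangles O ↔ {a, b, c} ∈ S.triangles ∧ O a b c := by
  simp [orientedTriangles]

theorem rotate_mem_orientedTriangles (hO : S.IsOrientation O) {a b c : V}
    (h : (a, b, c) ∈ S.orientedTriangles O) : (b, c, a) ∈ S.orientedTriangles O := by
  rw [mem_orientedTriangles] at *
  refine ⟨?_, hO.cyclic _ _ _ h.1 h.2⟩
  have : ({b, c, a} : Finset V) = {a, b, c} := by ext; simp; tauto
  rw [this]; exact h.1

theorem rotate_mem_orientedTriangles_iff (hO : S.IsOrientation O) {a b c : V} :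
    (b, c, a) ∈ S.orientedTriangles O ↔ (a, b, c) ∈ S.orientedTriangles O :=
  ⟨fun h => rotate_mem_orientedTriangles hO (rotate_mem_orientedTriangles hO h),
    rotate_mem_orientedTriangles hO⟩

theorem sum_orientedTriangles_rotate (hO : S.IsOrientation O) (f : V → V → V → ℤ) :
    ∑ q ∈ S.orientedTriangles O, f q.2.1 q.2.2 q.1 =
      ∑ q ∈ S.orientedTriangles O, f q.1 q.2.1 q.2.2 := by
  refine Finset.sum_bij' (fun q _ => (q.2.1, q.2.2, q.1)) (fun q _ => (q.2.2, q.1, q.2.1))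
    ?_ ?_ ?_ ?_ ?_
  · rintro ⟨a, b, c⟩ h; exact rotate_mem_orientedTriangles hO h
  · rintro ⟨a, b, c⟩ h
    exact rotate_mem_orientedTriangles hO (rotate_mem_orientedTriangles hO h)
  · rintro ⟨a, b, c⟩ h; rfl
  · rintro ⟨a, b, c⟩ h; rfl
  · rintro ⟨a, b, c⟩ h; rfl

/-- Of the six orderings of a triangle only the three cyclic rotations of one are positive. -/
theorem card_orientedTriangles_le (hO : S.IsOrientation O) :
    #(S.orientedTriangles O) ≤ 3 * #S.triangles := by
  classical
  have h1 : #(S.orientedTriangles O) ≤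
      #(S.triangles.biUnion fun t => {q ∈ S.orientedTriangles O | {q.1, q.2.1, q.2.2} = t}) := by
    refine Finset.card_le_card fun q hq => ?_
    obtain ⟨a, b, c⟩ := q
    rw [Finset.mem_biUnion]
    exact ⟨_, (mem_orientedTriangles.1 hq).1, Finset.mem_filter.2 ⟨hq, rfl⟩⟩
  refine h1.trans ((Finset.card_biUnion_le_card_mul _ _ 3 fun t ht => ?_).trans_eq (mul_comm _ _))
  rcases Finset.eq_empty_or_nonempty {q ∈ S.orientedTriangles O | {q.1, q.2.1, q.2.2} = t} with
    h | ⟨⟨a, b, c⟩, hq⟩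
  · rw [h]; simp
  rw [Finset.mem_filter] at hq
  obtain ⟨hq, rfl⟩ := hq
  have hm := mem_orientedTriangles.1 hq
  obtain ⟨hab, hac, hbc⟩ := S.ne_of_mem_triangles hm.1
  have h2 : ∀ {x y z : V}, (x, y, z) ∈ S.orientedTriangles O →
      (y, x, z) ∉ S.orientedTriangles O := by
    intro x y z h h'
    rw [mem_orientedTriangles] at h h'
    exact (hO.reverse x y z h.1).1 h'.2 h.2
  refine (Finset.card_le_card (t := {(a, b, c), (b, c, a), (c, a, b)}) ?_).trans
    Finset.card_le_three
  rintro ⟨x, y, z⟩ h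
  rw [Finset.mem_filter] at h
  obtain ⟨h, e⟩ := h
  simp only at e
  obtain ⟨hxy, hxz, hyz⟩ := S.ne_of_mem_triangles (mem_orientedTriangles.1 h).1
  have hx : x ∈ ({a, b, c} : Finset V) := by rw [← e]; simp
  have hy : y ∈ ({a, b, c} : Finset V) := by rw [← e]; simp
  have hz : z ∈ ({a, b, c} : Finset V) := by rw [← e]; simp
  simp only [Finset.mem_insert, Finset.mem_singleton] at hx hy hz ⊢
  have r1 := rotate_mem_orientedTriangles hO h
  have r2 := rotate_mem_orientedTriangles hO r1
  rcases hx with rfl | rfl | rfl <;> rcases hy with rfl | rfl | rfl <;>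
    rcases hz with rfl | rfl | rfl <;>
    first | (simp; done) | exact absurd rfl hxy | exact absurd rfl hxz | exact absurd rfl hyz |
      exact absurd h (h2 hq) | exact absurd r1 (h2 hq) | exact absurd r2 (h2 hq)

open Classical in
/-- The coefficient of the directed edge `ab` in the boundary of the oriented surface. -/
noncomputable def boundaryCoeff (S : TriangulatedSurface V) (O : V → V → V → Prop) (a b : V) : ℤ :=
  ∑ c, ((if (a, b, c) ∈ S.orientedTriangles O then 1 else 0) -
    (if (b, a, c) ∈ S.orientedTriangles O then 1 else 0))

theorem boundaryCoeff_antisymm (a b : V) : S.boundaryCoeff O b a = -S.boundaryCoeff O a b := by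
  simp only [boundaryCoeff, Finset.sum_sub_distrib]; ring

/-- The boundary is a cycle: an oriented triangle at `a` has one directed edge leaving `a` and one
arriving there. -/
theorem sum_boundaryCoeff (hO : S.IsOrientation O) (a : V) : ∑ b, S.boundaryCoeff O a b = 0 := by
  simp only [boundaryCoeff, Finset.sum_sub_distrib]
  rw [sub_eq_zero]
  conv_rhs => rw [Finset.sum_comm]
  refine Finset.sum_congr rfl fun b _ => Finset.sum_congr rfl fun c _ => ?_
  simp only [rotate_mem_orientedTriangles_iff hO (a := c) (b := a) (c := b)]

theorem card_triangles_filter_eq {a b : V} (hab : a ≠ b) :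
    #{t ∈ S.triangles | a ∈ t ∧ b ∈ t} = #{c : V | {a, b, c} ∈ S.triangles} := by
  symm
  refine Finset.card_bij (fun c _ => {a, b, c}) ?_ ?_ ?_
  · intro c hc
    simpa using hc
  · intro c hc d hd h
    simp only [Finset.mem_filter, Finset.mem_univ, true_and] at hc hd
    have h1 := S.ne_of_mem_triangles hc
    have : c ∈ ({a, b, d} : Finset V) := by rw [← h]; simp
    simp only [Finset.mem_insert, Finset.mem_singleton] at this
    rcases this with h' | h' | h'
    · exact absurd h'.symm h1.2.1
    · exact absurd h'.symm h1.2.2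
    · exact h'
  · intro t ht
    simp only [Finset.mem_filter] at ht
    obtain ⟨ht, ha, hb⟩ := ht
    have h3 := S.card_eq_three t ht
    have hsub : ({a, b} : Finset V) ⊆ t := by
      intro x hx; simp at hx; rcases hx with rfl | rfl <;> assumption
    have h1 : #(t \ {a, b}) = 1 := by
      rw [Finset.card_sdiff_of_subset hsub, h3, Finset.card_pair hab]
    obtain ⟨c, hc⟩ := Finset.card_eq_one.1 h1
    have e : ({a, b, c} : Finset V) = t := by
      rw [← Finset.union_sdiff_of_subset hsub, hc]
      ext; simp
    exact ⟨c, by simp [e, ht], e⟩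

theorem boundaryCoeff_eq_sum (hO : S.IsOrientation O) (a b : V)
    [∀ c, Decidable (O a b c)] : S.boundaryCoeff O a b =
      ∑ c ∈ ({c | {a, b, c} ∈ S.triangles} : Finset V), if O a b c then (1 : ℤ) else -1 := by
  rw [boundaryCoeff, Finset.sum_filter]
  refine Finset.sum_congr rfl fun c _ => ?_
  have e : ({b, a, c} : Finset V) = {a, b, c} := Finset.insert_comm _ _ _
  have m1 : (b, a, c) ∈ S.orientedTriangles O ↔ {a, b, c} ∈ S.triangles ∧ O b a c := by
    rw [mem_orientedTriangles, e]
  by_cases h : {a, b, c} ∈ S.triangles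
  · have := hO.reverse a b c h
    by_cases h' : O a b c <;> simp [h, this, h', m1, mem_orientedTriangles]
  · simp [h, m1, mem_orientedTriangles]

/-- At an edge of two triangles the induced orientations are opposite by coherence, so the
coefficients cancel. -/
theorem isBoundaryEdge_of_boundaryCoeff_ne_zero (hO : S.IsOrientation O) {a b : V}
    (h : S.boundaryCoeff O a b ≠ 0) : S.IsBoundaryEdge a b := by
  classical
  rw [boundaryCoeff_eq_sum hO] at h
  have hab : a ≠ b := by
    rintro rfl
    apply h
    refine Finset.sum_eq_zero fun c hc => ?_
    simp only [Finset.mem_filter, Finset.mem_univ, true_and] at hc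
    exact absurd rfl (S.ne_of_mem_triangles hc).1
  refine ⟨hab, ?_⟩
  have h2 := S.edge_le_two a b hab
  rw [card_triangles_filter_eq hab] at h2 ⊢
  by_contra hne
  have h3 : #{c : V | {a, b, c} ∈ S.triangles} = 0 ∨ #{c : V | {a, b, c} ∈ S.triangles} = 2 := by
    omega
  rcases h3 with h3 | h3
  · rw [Finset.card_eq_zero] at h3
    rw [h3] at h; simp at h
  · obtain ⟨c, d, hcd, he⟩ := Finset.card_eq_two.1 h3
    rw [he, Finset.sum_pair hcd] at h
    have hc : c ∈ ({c : V | {a, b, c} ∈ S.triangles} : Finset V) := by rw [he]; simp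
    have hd : d ∈ ({c : V | {a, b, c} ∈ S.triangles} : Finset V) := by rw [he]; simp
    simp only [Finset.mem_filter, Finset.mem_univ, true_and] at hc hd
    have i1 := hO.coherent a b c d hc hd hcd
    have i2 := hO.coherent a b d c hd hc hcd.symm
    have i3 := hO.reverse a b c hc
    have i4 := hO.reverse a b d hd
    have i5 : O b a c → O a b d := hO.coherent b a c d (by rwa [Finset.insert_comm])
      (by rwa [Finset.insert_comm]) hcd
    apply h
    by_cases h1 : O a b c <;> by_cases h2 : O a b d <;> simp [h1, h2] <;> tauto

theorem abs_boundaryCoeff (hO : S.IsOrientation O) {a b : V} (h : S.IsBoundaryEdge a b) :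
    |S.boundaryCoeff O a b| = 1 := by
  classical
  rw [boundaryCoeff_eq_sum hO]
  have h1 := h.2
  rw [card_triangles_filter_eq h.1] at h1
  obtain ⟨c, hc⟩ := Finset.card_eq_one.1 h1
  rw [hc, Finset.sum_singleton]
  split_ifs <;> simp

/-- Discrete Stokes formula. The factor `2` arises because the right side counts every edge in both
directions. -/
theorem two_mul_sum_orientedTriangles (Φ : V → V → ℤ) (hΦ : ∀ a b, Φ b a = -Φ a b) :
    2 * ∑ q ∈ S.orientedTriangles O, Φ q.1 q.2.1 =
      ∑ a, ∑ b, S.boundaryCoeff O a b * Φ a b := by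
  classical
  have e : ∑ q ∈ S.orientedTriangles O, Φ q.1 q.2.1 =
      ∑ a, ∑ b, ∑ c, (if (a, b, c) ∈ S.orientedTriangles O then 1 else 0) * Φ a b := by
    simp only [ite_mul, one_mul, zero_mul]
    rw [← Fintype.sum_ite_mem]
    simp only [Fintype.sum_prod_type]
  have e' : ∑ a, ∑ b, ∑ c, (if (b, a, c) ∈ S.orientedTriangles O then 1 else 0) * Φ a b =
      -∑ q ∈ S.orientedTriangles O, Φ q.1 q.2.1 := by
    rw [e, Finset.sum_comm]
    simp only [← Finset.sum_neg_distrib, ← mul_neg]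
    refine Finset.sum_congr rfl fun a _ => Finset.sum_congr rfl fun b _ =>
      Finset.sum_congr rfl fun c _ => ?_
    rw [hΦ a b]
  simp only [boundaryCoeff, Finset.sum_mul, sub_mul, Finset.sum_sub_distrib]
  rw [e', ← e]; ring

/-- The intersection number of a closed polygon with an oriented surface equals that with the cone
over the boundary of the surface. -/
theorem two_mul_sum_signedHit (hO : S.IsOrientation O) {p : V → E3} {n : ℕ} (Q : Fin n → E3)
    {o : E3} {Z : Set E3} (ho : o ∈ Z) (hp : ∀ v, p v ∈ Z)
    (hnd : ∀ a b c, {a, b, c} ∈ S.triangles → vol (p a - o) (p b - o) (p c - o) ≠ 0)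
    (hQ : ∀ i, IsGenericSegment Z (Q i) (Q (finRotate n i))) :
    2 * ∑ q ∈ S.orientedTriangles O, ∑ i,
        signedHit (Q i) (Q (finRotate n i)) (p q.1) (p q.2.1) (p q.2.2) =
      3 * ∑ a, ∑ b, S.boundaryCoeff O a b *
        ∑ i, signedHit (Q i) (Q (finRotate n i)) o (p a) (p b) := by
  set Φ : V → V → ℤ := fun a b => ∑ i, signedHit (Q i) (Q (finRotate n i)) o (p a) (p b)
  have hΦ : ∀ a b, Φ b a = -Φ a b := fun a b => by
    simp only [Φ, ← Finset.sum_neg_distrib]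
    exact Finset.sum_congr rfl fun i _ => signedHit_antisymm _ _ _ _ _
  have key : ∀ q ∈ S.orientedTriangles O,
      ∑ i, signedHit (Q i) (Q (finRotate n i)) (p q.1) (p q.2.1) (p q.2.2) =
        Φ q.2.1 q.2.2 + Φ q.2.2 q.1 + Φ q.1 q.2.1 := by
    rintro ⟨a, b, c⟩ hq
    obtain ⟨τ, hτ⟩ := exists_signedHit_tetrahedron (hnd a b c (mem_orientedTriangles.1 hq).1)
    simp only [Φ]
    rw [Finset.sum_congr rfl fun i _ => hτ Z _ _ ho (hp a) (hp b) (hp c) (hQ i)]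
    simp only [Finset.sum_add_distrib, Finset.sum_sub_distrib]
    -- The differences of `τ` cancel around the closed polygon.
    rw [Equiv.sum_comp (finRotate n) fun i => τ (Q i)]
    ring
  rw [Finset.sum_congr rfl key, ← two_mul_sum_orientedTriangles Φ hΦ, Finset.sum_add_distrib,
    Finset.sum_add_distrib, sum_orientedTriangles_rotate hO fun a b _ => Φ a b,
    ← sum_orientedTriangles_rotate hO fun a b c => Φ c a]
  ring

end TriangulatedSurface

/-! ### Segments on an embedded polygon -/

theorem isCompact_solidTriangle (a b c : E3) : IsCompact (solidTriangle a b c) := by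
  have h : solidTriangle a b c =
      (fun x : Fin 3 → ℝ => x 0 • a + x 1 • b + x 2 • c) '' stdSimplex ℝ (Fin 3) := by
    ext z
    constructor
    · rintro ⟨α, β, γ, h1, h2, h3, h4, rfl⟩
      refine ⟨![α, β, γ], ⟨?_, ?_⟩, by simp⟩
      · intro i; fin_cases i <;> simpa
      · simpa [Fin.sum_univ_three] using h4
    · rintro ⟨x, ⟨h1, h2⟩, rfl⟩
      exact ⟨x 0, x 1, x 2, h1 0, h1 1, h1 2, by rwa [Fin.sum_univ_three] at h2, rfl⟩
  rw [h]
  exact (isCompact_stdSimplex ℝ (Fin 3)).image (by fun_prop)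

theorem isCompact_segment (a b : E3) : IsCompact (segment ℝ a b) := by
  rw [segment_eq_image]
  exact isCompact_Icc.image (by fun_prop)

/-- An end point of a segment is not in the interior of a nondegenerate subsegment. -/
theorem combo_ne_left {a b u v : E3} (hu : u ∈ segment ℝ a b) (hv : v ∈ segment ℝ a b)
    (huv : u ≠ v) {t : ℝ} (t0 : 0 < t) (t1 : t < 1) : (1 - t) • u + t • v ≠ a := by
  intro h
  obtain ⟨r, r0, -, hr⟩ := exists_combo_of_mem_segment hu
  obtain ⟨s, s0, -, hs⟩ := exists_combo_of_mem_segment hv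
  have e : ((1 - t) * r + t * s) • (b - a) = 0 := by
    rw [← sub_eq_zero, hr, hs] at h
    rw [← h]; module
  rcases smul_eq_zero.1 e with e | e
  · have h1 : r = 0 := by nlinarith [mul_nonneg t0.le s0, mul_nonneg (sub_pos.2 t1).le r0]
    have h2 : s = 0 := by nlinarith [mul_nonneg t0.le s0, mul_nonneg (sub_pos.2 t1).le r0]
    exact huv (by rw [hr, hs, h1, h2])
  · obtain rfl : b = a := sub_eq_zero.1 e
    apply huv
    rw [hr, hs]; module

theorem combo_ne_right {a b u v : E3} (hu : u ∈ segment ℝ a b) (hv : v ∈ segment ℝ a b)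
    (huv : u ≠ v) {t : ℝ} (t0 : 0 < t) (t1 : t < 1) : (1 - t) • u + t • v ≠ b := by
  rw [segment_symm] at hu hv
  exact combo_ne_left hu hv huv t0 t1

theorem left_mem_affineSpan_of_segment {u v a b z w : E3} (hz : z ∈ affineSpan ℝ {u, v})
    (hw : w ∈ affineSpan ℝ {u, v}) (hzs : z ∈ segment ℝ a b) (hws : w ∈ segment ℝ a b)
    (hzw : z ≠ w) : a ∈ affineSpan ℝ {u, v} := by
  obtain ⟨r, -, -, hr⟩ := exists_combo_of_mem_segment hzs
  obtain ⟨s, -, -, hs⟩ := exists_combo_of_mem_segment hws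
  have hrs : s - r ≠ 0 := by
    intro h
    apply hzw
    rw [hr, hs, sub_eq_zero.1 h]
  have : a = AffineMap.lineMap z w (-r / (s - r)) := by
    rw [AffineMap.lineMap_apply_module']
    have e : w - z = (s - r) • (b - a) := by rw [hr, hs]; module
    rw [e, smul_smul, div_mul_cancel₀ _ hrs, hr]; module
  rw [this]
  exact AffineMap.lineMap_mem _ hz hw

namespace IsEmbeddedPolygon

variable {n : ℕ} {P : Polygon E3 n}

theorem ne_next (hP : IsEmbeddedPolygon P) (i : Fin n) : P i ≠ P (finRotate n i) := by
  intro h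
  have := hP.not_collinear i
  rw [h, Set.insert_eq_of_mem (Set.mem_insert _ _)] at this
  exact this (collinear_pair ℝ _ _)

theorem eq_of_mem_of_mem (hP : IsEmbeddedPolygon P) {i j : Fin n} (hij : i ≠ j) {z : E3}
    (hi : z ∈ P.edgeSet ℝ i) (hj : z ∈ P.edgeSet ℝ j) :
    (j = finRotate n i ∧ z = P j) ∨ (i = finRotate n j ∧ z = P i) := by
  by_cases h1 : j = finRotate n i
  · left
    subst h1
    have : z ∈ P.edgeSet ℝ i ∩ P.edgeSet ℝ (finRotate n i) := ⟨hi, hj⟩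
    rw [hP.consecutive] at this
    exact ⟨rfl, this⟩
  by_cases h2 : i = finRotate n j
  · right
    subst h2
    have : z ∈ P.edgeSet ℝ j ∩ P.edgeSet ℝ (finRotate n j) := ⟨hj, hi⟩
    rw [hP.consecutive] at this
    exact ⟨rfl, this⟩
  exact absurd hj (Set.disjoint_left.1 (hP.disjoint i j hij h1 h2) hi)

theorem eq_endpoint_of_mem_of_mem (hP : IsEmbeddedPolygon P) {i j : Fin n} (hij : i ≠ j) {z : E3}
    (hi : z ∈ P.edgeSet ℝ i) (hj : z ∈ P.edgeSet ℝ j) : z = P j ∨ z = P (finRotate n j) := by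
  rcases hP.eq_of_mem_of_mem hij hi hj with ⟨-, h⟩ | ⟨h, h'⟩
  · exact Or.inl h
  · right; rw [h', h]

/-- A point lies on at most two edges, which are consecutive. -/
theorem exists_edges_of_point (hP : IsEmbeddedPolygon P) (z : E3) :
    ∃ i₀, ∀ i, z ∈ P.edgeSet ℝ i → i = i₀ ∨ i = finRotate n i₀ := by
  have hn := hP.three_le
  by_cases h : ∃ i, z ∈ P.edgeSet ℝ i ∧ z ∈ P.edgeSet ℝ (finRotate n i)
  · obtain ⟨i, h1, h2⟩ := h
    have hz : z = P (finRotate n i) := by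
      have : z ∈ P.edgeSet ℝ i ∩ P.edgeSet ℝ (finRotate n i) := ⟨h1, h2⟩
      rwa [hP.consecutive] at this
    refine ⟨i, fun j hj => ?_⟩
    by_contra hne
    push Not at hne
    rcases hP.eq_of_mem_of_mem hne.1.symm h1 hj with ⟨h3, -⟩ | ⟨h3, h4⟩
    · exact hne.2 h3
    · exact hP.ne_next i (h4.symm.trans hz)
  · push Not at h
    by_cases h0 : ∃ i, z ∈ P.edgeSet ℝ i
    · obtain ⟨i, hi⟩ := h0
      refine ⟨i, fun j hj => ?_⟩
      by_contra hne
      push Not at hne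
      rcases hP.eq_of_mem_of_mem hne.1.symm hi hj with ⟨h3, -⟩ | ⟨h3, -⟩
      · exact hne.2 h3
      · exact h j hj (h3 ▸ hi)
    · push Not at h0
      exact ⟨⟨0, by omega⟩, fun i hi => absurd hi (h0 i)⟩

/-- A segment contained in the polygon is contained in one of its edges. -/
theorem exists_edge_of_segment_subset (hP : IsEmbeddedPolygon P) {u v : E3} (huv : u ≠ v)
    (h : segment ℝ u v ⊆ P.boundary ℝ) : ∃ j, segment ℝ u v ⊆ P.edgeSet ℝ j := by
  set f : ℝ → E3 := fun t => (1 - t) • u + t • v with hf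
  have hfc : Continuous f := by fun_prop
  have hfinj : Function.Injective f := by
    intro s t hst
    have : (s - t) • (v - u) = 0 := by
      have := sub_eq_zero.2 hst
      rw [← this, hf]; module
    rcases smul_eq_zero.1 this with h | h
    · linarith
    · exact absurd (sub_eq_zero.1 h).symm huv
  have hfspan : ∀ t, f t ∈ affineSpan ℝ {u, v} := by
    intro t
    have : f t = AffineMap.lineMap u v t := by rw [AffineMap.lineMap_apply_module]
    rw [this]
    exact AffineMap.lineMap_mem_affineSpan_pair _ _ _
  set J : Fin n → Set ℝ := fun l => Set.Icc 0 1 ∩ f ⁻¹' P.edgeSet ℝ l with hJ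
  have hclosed : ∀ l, IsClosed (J l) := by
    intro l
    refine isClosed_Icc.inter (IsClosed.preimage hfc ?_)
    rw [edgeSet_eq_segment]
    exact (isCompact_segment _ _).isClosed
  have hcover : Set.Icc (0 : ℝ) 1 ⊆ ⋃ l, J l := by
    intro t ht
    have := h (combo_mem_segment (x := u) (y := v) ht.1 ht.2)
    rw [Polygon.boundary, Set.mem_iUnion] at this
    obtain ⟨l, hl⟩ := this
    exact Set.mem_iUnion.2 ⟨l, ht, hl⟩
  have hspan : ∀ l, (J l).Nontrivial → P l ∈ affineSpan ℝ {u, v} ∧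
      P (finRotate n l) ∈ affineSpan ℝ {u, v} := by
    rintro l ⟨s, hs, t, ht, hst⟩
    have h1 := hs.2
    have h2 := ht.2
    rw [Set.mem_preimage, edgeSet_eq_segment] at h1 h2
    refine ⟨left_mem_affineSpan_of_segment (hfspan s) (hfspan t) h1 h2 (hfinj.ne hst), ?_⟩
    rw [segment_symm] at h1 h2
    exact left_mem_affineSpan_of_segment (hfspan s) (hfspan t) h1 h2 (hfinj.ne hst)
  -- Two consecutive edges that both overlap the line `uv` in more than a point would be collinear.
  have hadj : ∀ l, (J l).Nontrivial → (J (finRotate n l)).Nontrivial → False := by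
    intro l h1 h2
    exact hP.not_collinear l (collinear_triple_of_mem_affineSpan_pair (hspan l h1).1
      (hspan l h1).2 (hspan _ h2).2)
  obtain ⟨i, hi⟩ : ∃ i, (J i).Nontrivial := by
    by_contra hcon
    push Not at hcon
    have : (⋃ l, J l).Finite := Set.finite_iUnion fun l => (hcon l).finite
    exact (Set.Icc_infinite (zero_lt_one (α := ℝ))) (this.subset hcover)
  refine ⟨i, ?_⟩
  -- `B` collects the other edges that overlap the segment substantially, and `F` the finitely many
  -- accidental contacts. The latter can be discarded since `J i` and `B` are closed and the
  -- complement of `F` is dense.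
  set B : Set ℝ := ⋃ l, ⋃ (_ : (J l).Nontrivial ∧ l ≠ i), J l with hB
  set F : Set ℝ := ⋃ l, ⋃ (_ : ¬ (J l).Nontrivial), J l with hF
  have hBc : IsClosed B := isClosed_iUnion_of_finite fun l =>
    isClosed_iUnion_of_finite fun _ => hclosed l
  have hFfin : F.Finite := Set.finite_iUnion fun l => Set.finite_iUnion fun hl =>
    (Set.not_nontrivial_iff.1 hl).finite
  have hsub : Set.Ioo (0 : ℝ) 1 ∩ Fᶜ ⊆ J i ∪ B := by
    rintro t ⟨ht, htF⟩
    obtain ⟨l, hl⟩ := Set.mem_iUnion.1 (hcover (Set.Ioo_subset_Icc_self ht))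
    by_cases hli : l = i
    · left; exact hli ▸ hl
    · right
      have hnt : (J l).Nontrivial := by
        by_contra hcon
        exact htF (Set.mem_iUnion.2 ⟨l, Set.mem_iUnion.2 ⟨hcon, hl⟩⟩)
      exact Set.mem_iUnion.2 ⟨l, Set.mem_iUnion.2 ⟨⟨hnt, hli⟩, hl⟩⟩
  have hIcc : Set.Icc (0 : ℝ) 1 ⊆ J i ∪ B := by
    have h1 : Set.Ioo (0 : ℝ) 1 ⊆ closure (Set.Ioo 0 1 ∩ Fᶜ) :=
      (hFfin.countable.dense_compl ℝ).open_subset_closure_inter isOpen_Ioo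
    have h2 : closure (Set.Ioo (0 : ℝ) 1 ∩ Fᶜ) ⊆ J i ∪ B :=
      closure_minimal hsub ((hclosed i).union hBc)
    rw [← closure_Ioo (zero_ne_one (α := ℝ))]
    exact closure_minimal (h1.trans h2) ((hclosed i).union hBc)
  have hdisj : ¬ (Set.Icc (0 : ℝ) 1 ∩ (J i ∩ B)).Nonempty := by
    rintro ⟨t, -, hti, htB⟩
    obtain ⟨l, hl⟩ := Set.mem_iUnion.1 htB
    obtain ⟨⟨hnt, hli⟩, hl⟩ := Set.mem_iUnion.1 hl
    rcases hP.eq_of_mem_of_mem hli hl.2 hti.2 with ⟨h1, -⟩ | ⟨h1, -⟩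
    · exact hadj l hnt (h1 ▸ hi)
    · exact hadj i hi (h1 ▸ hnt)
  -- Connectedness: the interval is covered by the disjoint closed sets `J i` and `B`, and it meets
  -- `J i`.
  have hBe : ¬ (Set.Icc (0 : ℝ) 1 ∩ B).Nonempty := fun hne => hdisj
    (isPreconnected_closed_iff.1 isPreconnected_Icc _ _ (hclosed i) hBc hIcc
      (by obtain ⟨t, ht⟩ := hi.nonempty; exact ⟨t, ht.1, ht⟩) hne)
  intro z hz
  obtain ⟨t, t0, t1, rfl⟩ := exists_combo_of_mem_segment hz
  rcases hIcc ⟨t0, t1⟩ with h' | h'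
  · exact h'.2
  · exact absurd ⟨t, ⟨t0, t1⟩, h'⟩ hBe

end IsEmbeddedPolygon

/-! ### How the surface meets its bounding polygon -/

namespace TriangulatedSurface

variable {V : Type*} [Fintype V]

theorem realize_add (p : V → E3) (x y : V → ℝ) : realize p (x + y) = realize p x + realize p y := by
  simp [realize, add_smul, Finset.sum_add_distrib]

theorem realize_smul (p : V → E3) (r : ℝ) (x : V → ℝ) : realize p (r • x) = r • realize p x := by
  simp [realize, mul_smul, Finset.smul_sum]

theorem realize_sub (p : V → E3) (x y : V → ℝ) : realize p (x - y) = realize p x - realize p y := by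
  simp [realize, sub_smul, Finset.sum_sub_distrib]

variable [DecidableEq V]

theorem realize_single (p : V → E3) (a : V) : realize p (Pi.single a 1) = p a := by
  rw [realize, Finset.sum_eq_single a] <;> simp +contextual

theorem realize_combo (p : V → E3) (a b : V) (t : ℝ) :
    realize p ((1 - t) • Pi.single a 1 + t • Pi.single b 1) = (1 - t) • p a + t • p b := by
  rw [realize_add, realize_smul, realize_smul, realize_single, realize_single]

variable {S : TriangulatedSurface V} {p : V → E3} {n : ℕ} {P : Polygon E3 n}

theorem IsBoundaryEdge.symm {a b : V} (h : S.IsBoundaryEdge a b) : S.IsBoundaryEdge b a := by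
  refine ⟨h.1.symm, ?_⟩
  rw [← h.2]
  congr 1
  ext t
  simp only [Finset.mem_filter]; tauto

theorem combo_mem_boundary {a b : V} (h : S.IsBoundaryEdge a b) {t : ℝ} (t0 : 0 ≤ t) (t1 : t ≤ 1) :
    (1 - t) • Pi.single a (1 : ℝ) + t • Pi.single b 1 ∈ S.boundary := by
  refine ⟨?_, a, b, h, ?_⟩
  · exact convex_stdSimplex ℝ V (single_mem_stdSimplex ℝ a) (single_mem_stdSimplex ℝ b)
      (sub_nonneg.2 t1) t0 (by ring)
  · intro v hv
    by_contra hcon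
    push Not at hcon
    apply hv
    simp [hcon]

theorem single_mem_boundary {a b : V} (h : S.IsBoundaryEdge a b) :
    Pi.single a (1 : ℝ) ∈ S.boundary := by
  simpa using combo_mem_boundary h le_rfl zero_le_one

theorem exists_combo_of_mem_boundary {x : V → ℝ} (hx : x ∈ S.boundary) :
    ∃ a b, S.IsBoundaryEdge a b ∧ ∃ t : ℝ, 0 ≤ t ∧ t ≤ 1 ∧
      x = (1 - t) • Pi.single a (1 : ℝ) + t • Pi.single b 1 := by
  obtain ⟨hx, a, b, hab, hs⟩ := hx
  have hsum : x a + x b = 1 := by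
    rw [← hx.2, ← Finset.sum_pair hab.1]
    refine Finset.sum_subset (Finset.subset_univ _) fun v _ hv => ?_
    by_contra hne
    rcases hs v hne with rfl | rfl <;> simp at hv
  refine ⟨a, b, hab, x b, hx.1 b, by linarith [hx.1 a], ?_⟩
  ext v
  by_cases hva : v = a
  · subst hva
    simp [hab.1]; linarith
  by_cases hvb : v = b
  · subst hvb
    simp [hva]
  · have : x v = 0 := by
      by_contra hne
      rcases hs v hne with h | h
      · exact hva h
      · exact hvb h
    simp [hva, hvb, this]

theorem IsComplementaryImmersed.ne_of_isBoundaryEdge (hc : S.IsComplementaryImmersed p) {a b c d : V}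
    (hab : S.IsBoundaryEdge a b) (hcd : S.IsBoundaryEdge c d) (hac : a ≠ c) : p a ≠ p c := by
  intro h
  have := hc.boundary_embedded (single_mem_boundary hab) (single_mem_boundary hcd)
    (by rw [realize_single, realize_single, h])
  have := congrFun this a
  simp [hac] at this

theorem Bounds.segment_subset (hB : S.Bounds p P) {a b : V} (hab : S.IsBoundaryEdge a b) :
    segment ℝ (p a) (p b) ⊆ P.boundary ℝ := by
  intro z hz
  obtain ⟨t, t0, t1, rfl⟩ := exists_combo_of_mem_segment hz
  rw [← hB, ← realize_combo]
  exact Set.mem_image_of_mem _ (combo_mem_boundary hab t0 t1)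

theorem Bounds.exists_edge (hB : S.Bounds p P) (hP : IsEmbeddedPolygon P)
    (hc : S.IsComplementaryImmersed p) {a b : V} (hab : S.IsBoundaryEdge a b) :
    ∃ j, segment ℝ (p a) (p b) ⊆ P.edgeSet ℝ j :=
  hP.exists_edge_of_segment_subset (hc.ne_of_isBoundaryEdge hab hab.symm hab.1)
    (hB.segment_subset hab)

/-- If a triangle of the surface meets an edge of the bounding polygon, then one of its vertices
lies on this edge. -/
theorem Bounds.exists_vertex_mem_edge (hB : S.Bounds p P) (hP : IsEmbeddedPolygon P)
    (hc : S.IsComplementaryImmersed p) {a b c : V} (ht : {a, b, c} ∈ S.triangles) {z : E3}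
    {i : Fin n} (hz : z ∈ P.edgeSet ℝ i) (hzt : z ∈ solidTriangle (p a) (p b) (p c)) :
    p a ∈ P.edgeSet ℝ i ∨ p b ∈ P.edgeSet ℝ i ∨ p c ∈ P.edgeSet ℝ i := by
  suffices h : ∃ v ∈ ({a, b, c} : Finset V), p v ∈ P.edgeSet ℝ i by
    obtain ⟨v, hv, h⟩ := h
    simp only [Finset.mem_insert, Finset.mem_singleton] at hv
    rcases hv with rfl | rfl | rfl <;> tauto
  obtain ⟨α, β, γ, h1, h2, h3, h4, hze⟩ := hzt
  set x : V → ℝ := α • Pi.single a 1 + β • Pi.single b 1 + γ • Pi.single c 1 with hx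
  have hxs : x ∈ stdSimplex ℝ V := by
    constructor
    · intro v
      simp only [hx, Pi.add_apply, Pi.smul_apply, smul_eq_mul, Pi.single_apply]
      have := h1; have := h2; have := h3
      split_ifs <;> simp <;> linarith
    · simp [hx, Finset.sum_add_distrib, ← Finset.mul_sum, h4]
  have hxt : ∀ v, x v ≠ 0 → v ∈ ({a, b, c} : Finset V) := by
    intro v hv
    by_contra hcon
    simp only [Finset.mem_insert, Finset.mem_singleton, not_or] at hcon
    apply hv
    simp [hx, hcon]
  have hxz : realize p x = z := by
    rw [hx, realize_add, realize_add, realize_smul, realize_smul, realize_smul, realize_single,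
      realize_single, realize_single, hze]
  -- Complementarity enters here: a point of the surface that is mapped to the polygon is a boundary
  -- point.
  have hxb : x ∈ S.boundary := by
    by_contra hcon
    have hzP : z ∈ realize p '' S.boundary := by
      rw [hB]; exact Set.mem_iUnion.2 ⟨i, hz⟩
    exact Set.disjoint_left.1 hc.complementary ⟨x, ⟨⟨hxs, _, ht, hxt⟩, hcon⟩, hxz⟩ hzP
  obtain ⟨a', b', hab, t, t0, t1, he⟩ := exists_combo_of_mem_boundary hxb
  have hxa : x a' = 1 - t := by rw [he]; simp [hab.1]
  have hxb' : x b' = t := by rw [he]; simp [hab.1.symm]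
  have hz' : z = (1 - t) • p a' + t • p b' := by rw [← hxz, he, realize_combo]
  rcases eq_or_lt_of_le t0 with rfl | t0
  · refine ⟨a', hxt a' (by rw [hxa]; norm_num), ?_⟩
    rw [hz'] at hz; simpa using hz
  rcases eq_or_lt_of_le t1 with rfl | t1
  · refine ⟨b', hxt b' (by rw [hxb']; norm_num), ?_⟩
    rw [hz'] at hz; simpa using hz
  refine ⟨a', hxt a' (by rw [hxa]; linarith), ?_⟩
  obtain ⟨j, hj⟩ := hB.exists_edge hP hc hab
  have ha := hj (left_mem_segment ℝ _ _)
  have hb := hj (right_mem_segment ℝ _ _)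
  have hzj := hj (combo_mem_segment t0.le t1.le)
  -- For distinct edges the point would be an end point of edge `j`, yet it is interior to a
  -- nondegenerate subsegment of that edge.
  by_cases hij : i = j
  · rw [hij]; exact ha
  exfalso
  rw [edgeSet_eq_segment] at ha hb
  have hne := hc.ne_of_isBoundaryEdge hab hab.symm hab.1
  rw [← hz'] at hzj
  rcases hP.eq_endpoint_of_mem_of_mem hij hz hzj with h | h
  · exact combo_ne_left ha hb hne t0 t1 (hz'.symm.trans h)
  · exact combo_ne_right ha hb hne t0 t1 (hz'.symm.trans h)

/-- After a small translation, an edge of the polygon only hits triangles with a vertex on it. -/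
theorem Bounds.eventually_vertex_mem_edge (hB : S.Bounds p P) (hP : IsEmbeddedPolygon P)
    (hc : S.IsComplementaryImmersed p) :
    ∀ᶠ w in nhds (0 : E3), ∀ (i : Fin n) (a b c : V), {a, b, c} ∈ S.triangles →
      Hits (P i + w) (P (finRotate n i) + w) (p a) (p b) (p c) →
        p a ∈ P.edgeSet ℝ i ∨ p b ∈ P.edgeSet ℝ i ∨ p c ∈ P.edgeSet ℝ i := by
  rw [Filter.eventually_all]; intro i
  rw [Filter.eventually_all]; intro a
  rw [Filter.eventually_all]; intro b
  rw [Filter.eventually_all]; intro c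
  rw [Filter.eventually_imp_distrib_left]; intro ht
  -- A triangle disjoint from the compact edge stays disjoint after a small translation; one that
  -- meets it already has a vertex there.
  by_cases hd : Disjoint (P.edgeSet ℝ i) (solidTriangle (p a) (p b) (p c))
  · have hcomp : IsCompact (P.edgeSet ℝ i) := by
      rw [edgeSet_eq_segment]; exact isCompact_segment _ _
    obtain ⟨δ, δ0, hδ⟩ := hd.exists_thickenings hcomp (isCompact_solidTriangle _ _ _).isClosed
    filter_upwards [Metric.ball_mem_nhds (0 : E3) δ0] with w hw hH
    exfalso
    obtain ⟨z, hz, hzt⟩ := hH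
    obtain ⟨t, t0, t1, rfl⟩ := exists_combo_of_mem_segment hz
    refine Set.disjoint_left.1 hδ ?_ (Metric.self_subset_thickening δ0 _ hzt)
    rw [Metric.mem_thickening_iff]
    refine ⟨(1 - t) • P i + t • P (finRotate n i), ?_, ?_⟩
    · rw [edgeSet_eq_segment]; exact combo_mem_segment t0 t1
    · rw [dist_eq_norm]
      have : (1 - t) • (P i + w) + t • (P (finRotate n i) + w) -
          ((1 - t) • P i + t • P (finRotate n i)) = w := by module
      rw [this]; simpa using hw
  · rw [Set.not_disjoint_iff] at hd
    obtain ⟨z, hz, hzt⟩ := hd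
    exact Filter.Eventually.of_forall fun w _ => hB.exists_vertex_mem_edge hP hc ht hz hzt

/-- Exactly one boundary edge of the surface lies on a given edge of the polygon and ends at the
second end point of this edge. -/
theorem Bounds.exists_unique_last_edge (hB : S.Bounds p P) (hP : IsEmbeddedPolygon P)
    (hc : S.IsComplementaryImmersed p) (j : Fin n) :
    ∃ a b, S.IsBoundaryEdge a b ∧ p b = P (finRotate n j) ∧
      segment ℝ (p a) (p b) ⊆ P.edgeSet ℝ j ∧
      ∀ a' b', S.IsBoundaryEdge a' b' → p b' = P (finRotate n j) →
        segment ℝ (p a') (p b') ⊆ P.edgeSet ℝ j → a' = a ∧ b' = b := by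
  set X := P (finRotate n j) with hX
  set Y := P j with hY
  have hXY : X ≠ Y := (hP.ne_next j).symm
  have hedge : P.edgeSet ℝ j = segment ℝ X Y := by rw [edgeSet_eq_segment, segment_symm]
  have hinj : ∀ s t : ℝ, (1 - s) • X + s • Y = (1 - t) • X + t • Y → s = t := by
    intro s t h
    have : (s - t) • (Y - X) = 0 := by
      rw [← sub_eq_zero] at h
      rw [← h]; module
    rcases smul_eq_zero.1 this with h | h
    · linarith
    · exact absurd (sub_eq_zero.1 h).symm hXY
  -- Close to `X`, but not at `X`, there are no images of vertices. A boundary edge through such a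
  -- nearby point must therefore end at `X`.
  have hev : ∀ᶠ t in nhdsWithin (0 : ℝ) (Set.Ioi 0), ∀ v : V, ∀ s : ℝ, 0 < s → s ≤ t →
      p v ≠ (1 - s) • X + s • Y := by
    rw [Filter.eventually_all]
    intro v
    by_cases h : ∃ s : ℝ, 0 < s ∧ p v = (1 - s) • X + s • Y
    · obtain ⟨s, s0, hs⟩ := h
      filter_upwards [Ioo_mem_nhdsGT s0] with t ht u u0 hut hu
      have := hinj s u (hs.symm.trans hu)
      have := ht.2
      linarith
    · push Not at h
      exact Filter.Eventually.of_forall fun t s s0 _ => h s s0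
  obtain ⟨t, ht, htI⟩ := (hev.and (Ioo_mem_nhdsGT (zero_lt_one (α := ℝ)))).exists
  have hzj : (1 - t) • X + t • Y ∈ P.edgeSet ℝ j := by
    rw [hedge]; exact combo_mem_segment htI.1.le htI.2.le
  have hzP : (1 - t) • X + t • Y ∈ realize p '' S.boundary := by
    rw [hB]; exact Set.mem_iUnion.2 ⟨j, hzj⟩
  obtain ⟨x, hx, hxz⟩ := hzP
  obtain ⟨a, b, hab, u, u0, u1, rfl⟩ := exists_combo_of_mem_boundary hx
  rw [realize_combo] at hxz
  obtain ⟨i, hi⟩ := hB.exists_edge hP hc hab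
  have hij : i = j := by
    by_contra hne
    have hzi := hi (combo_mem_segment u0 u1)
    rw [hxz] at hzi
    rcases hP.eq_endpoint_of_mem_of_mem hne hzi hzj with h | h
    · exact combo_ne_right (left_mem_segment ℝ X Y) (right_mem_segment ℝ X Y) hXY htI.1 htI.2 h
    · exact combo_ne_left (left_mem_segment ℝ X Y) (right_mem_segment ℝ X Y) hXY htI.1 htI.2 h
  subst hij
  have ex : ∃ a b, S.IsBoundaryEdge a b ∧ p b = X ∧ segment ℝ (p a) (p b) ⊆ P.edgeSet ℝ i := by
    have ha := hi (left_mem_segment ℝ _ _)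
    have hb := hi (right_mem_segment ℝ _ _)
    rw [hedge] at ha hb
    obtain ⟨r, r0, -, hr⟩ := exists_combo_of_mem_segment ha
    obtain ⟨s, s0, -, hs⟩ := exists_combo_of_mem_segment hb
    have hts : (1 - u) * r + u * s = t := by
      apply hinj
      rw [← hxz, hr, hs]; module
    rcases le_total r s with hrs | hrs
    · have hrt : r ≤ t := by nlinarith
      refine ⟨b, a, hab.symm, ?_, by rwa [segment_symm]⟩
      rcases eq_or_lt_of_le r0 with rfl | r0
      · rw [hr]; simp
      · exact absurd hr (ht a r r0 hrt)
    · have hst : s ≤ t := by nlinarith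
      refine ⟨a, b, hab, ?_, hi⟩
      rcases eq_or_lt_of_le s0 with rfl | s0
      · rw [hs]; simp
      · exact absurd hs (ht b s s0 hst)
  clear hab hi hx hxz a b
  obtain ⟨a, b, hab, hbX, hseg⟩ := ex
  refine ⟨a, b, hab, hbX, hseg, ?_⟩
  intro a' b' hab' hbX' hseg'
  have hbb : b' = b := by
    by_contra hne
    exact hc.ne_of_isBoundaryEdge hab'.symm hab.symm hne (hbX'.trans hbX.symm)
  subst hbb
  refine ⟨?_, rfl⟩
  -- Two boundary edges leaving `b'` along the same ray overlap: the nearer end point is also a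
  -- point of the other edge, against the injectivity on the boundary.
  have key : ∀ {a a' : V}, S.IsBoundaryEdge a b' → S.IsBoundaryEdge a' b' → ∀ r s : ℝ, 0 < r →
      r ≤ s → p a = (1 - r) • X + r • Y → p a' = (1 - s) • X + s • Y → a' = a := by
    intro a a' h h' r s r0 hrs hr hs
    by_contra hne
    have s0 : s ≠ 0 := by linarith
    have e : realize p (Pi.single a 1) =
        realize p ((1 - r / s) • Pi.single b' 1 + (r / s) • Pi.single a' 1) := by
      rw [realize_single, realize_combo, hr, hs, hbX, smul_add, smul_smul, smul_smul,
        div_mul_cancel₀ _ s0]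
      have : r / s * (1 - s) = r / s - r := by field_simp
      rw [this]; module
    have := hc.boundary_embedded (single_mem_boundary h) (combo_mem_boundary h'.symm
      (div_nonneg r0.le (r0.le.trans hrs)) ((div_le_one (by linarith)).2 hrs)) e
    have := congrFun this a
    simp [h.1, Ne.symm hne] at this
  have param : ∀ {a : V}, S.IsBoundaryEdge a b' → segment ℝ (p a) (p b') ⊆ P.edgeSet ℝ i →
      ∃ r : ℝ, 0 < r ∧ p a = (1 - r) • X + r • Y := by
    intro a h hs
    have ha := hs (left_mem_segment ℝ _ _)
    rw [hedge] at ha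
    obtain ⟨r, r0, -, hr⟩ := exists_combo_of_mem_segment ha
    refine ⟨r, lt_of_le_of_ne r0 ?_, hr⟩
    rintro rfl
    refine hc.ne_of_isBoundaryEdge h h.symm h.1 ?_
    rw [hr, hbX]; simp
  obtain ⟨r, r0, hr⟩ := param hab hseg
  obtain ⟨s, s0, hs⟩ := param hab' hseg'
  rcases le_total r s with h | h
  · exact key hab hab' r s r0 h hr hs
  · exact (key hab' hab s r s0 h hs hr).symm

/-- The images of the triangles of an immersed surface are nondegenerate. -/
theorem IsComplementaryImmersed.eq_zero_of_combo (hc : S.IsComplementaryImmersed p) {a b c : V}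
    (ht : {a, b, c} ∈ S.triangles) {r s : ℝ} (h : r • (p b - p a) + s • (p c - p a) = 0) :
    r = 0 ∧ s = 0 := by
  obtain ⟨hab, hac, hbc⟩ := S.ne_of_mem_triangles ht
  -- A relation among the sides gives a direction `d` that `realize p` kills. Moving from the
  -- barycentre `m` along `d` stays in the triangle, so local injectivity forces `d = 0`.
  set d : V → ℝ := r • (Pi.single b 1 - Pi.single a 1) + s • (Pi.single c 1 - Pi.single a 1) with hd
  set m : V → ℝ := (1 / 3 : ℝ) • (Pi.single a 1 + Pi.single b 1 + Pi.single c 1) with hm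
  have hda : d a = -r - s := by simp [hd, hab, hac]; ring
  have hdb : d b = r := by simp [hd, hab.symm, hbc]
  have hdc : d c = s := by simp [hd, hac.symm, hbc.symm]
  have hdv : ∀ v, v ∉ ({a, b, c} : Finset V) → d v = 0 := by
    intro v hv
    simp only [Finset.mem_insert, Finset.mem_singleton, not_or] at hv
    simp [hd, hv]
  have hma : m a = 1 / 3 := by simp [hm, hab, hac]
  have hmb : m b = 1 / 3 := by simp [hm, hab.symm, hbc]
  have hmc : m c = 1 / 3 := by simp [hm, hac.symm, hbc.symm]
  have hmv : ∀ v, v ∉ ({a, b, c} : Finset V) → m v = 0 := by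
    intro v hv
    simp only [Finset.mem_insert, Finset.mem_singleton, not_or] at hv
    simp [hm, hv]
  have hdr : realize p d = 0 := by
    rw [← h, hd, realize_add, realize_smul, realize_smul, realize_sub, realize_sub]
    simp only [realize_single]
  have hsum1 : ∑ v, m v = 1 := by
    rw [hm]; simp [← Finset.mul_sum, Finset.sum_add_distrib]; norm_num
  have hsum0 : ∑ v, d v = 0 := by
    rw [hd]; simp [← Finset.mul_sum, Finset.sum_add_distrib, Finset.sum_sub_distrib]
  have hev : ∀ᶠ ε in nhds (0 : ℝ), m + ε • d ∈ S.carrier := by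
    have pos : ∀ v ∈ ({a, b, c} : Finset V), ∀ᶠ ε in nhds (0 : ℝ), 0 < m v + ε * d v := by
      intro v hv
      have hcont : Continuous fun ε : ℝ => m v + ε * d v := by fun_prop
      refine continuousAt_const.eventually_lt hcont.continuousAt ?_
      simp only [Finset.mem_insert, Finset.mem_singleton] at hv
      rcases hv with rfl | rfl | rfl
      · rw [hma]; norm_num
      · rw [hmb]; norm_num
      · rw [hmc]; norm_num
    filter_upwards [pos a (by simp), pos b (by simp), pos c (by simp)] with ε ea eb ec
    refine ⟨⟨?_, ?_⟩, _, ht, ?_⟩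
    · intro v
      by_cases hv : v ∈ ({a, b, c} : Finset V)
      · simp only [Finset.mem_insert, Finset.mem_singleton] at hv
        rcases hv with rfl | rfl | rfl
        · exact ea.le
        · exact eb.le
        · exact ec.le
      · simp [hmv v hv, hdv v hv]
    · simp [Finset.sum_add_distrib, ← Finset.mul_sum, hsum1, hsum0]
    · intro v hv
      by_contra hcon
      exact hv (by simp [hmv v hcon, hdv v hcon])
  have hmc' : m ∈ S.carrier := by simpa using hev.self_of_nhds
  obtain ⟨U, hU, hmU, hinj⟩ := hc.immersed ⟨m, hmc'⟩
  obtain ⟨W, hW, rfl⟩ := isOpen_induced_iff.1 hU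
  have hev2 : ∀ᶠ ε in nhds (0 : ℝ), m + ε • d ∈ W := by
    have hcont : Continuous fun ε : ℝ => m + ε • d := by fun_prop
    exact hcont.continuousAt.eventually_mem (by simpa using hW.mem_nhds hmU)
  have hev3 := ((hev.and hev2).filter_mono nhdsWithin_le_nhds).and
    (self_mem_nhdsWithin (a := (0 : ℝ)) (s := Set.Ioi 0))
  obtain ⟨ε, ⟨hε1, hε2⟩, hε0⟩ := hev3.exists
  have := hinj (x₁ := ⟨m + ε • d, hε1⟩) (x₂ := ⟨m, hmc'⟩) hε2 hmU (by
    show realize p (m + ε • d) = realize p m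
    rw [realize_add, realize_smul p ε d, hdr]; simp)
  have hd0 : ε • d = 0 := by simpa using congrArg Subtype.val this
  have hd0' : d = 0 := (smul_eq_zero.1 hd0).resolve_left (ne_of_gt hε0)
  exact ⟨by rw [← hdb, hd0']; rfl, by rw [← hdc, hd0']; rfl⟩

end TriangulatedSurface

/-! ### At most three net crossings per triangle, and the potential along the polygon -/

theorem abs_sum_subset_pair_le_one {n : ℕ} (hn : 3 ≤ n) {f : Fin n → ℤ} (h1 : ∀ i, |f i| ≤ 1)
    (h2 : ∀ i, |f i + f (finRotate n i)| ≤ 1) (i : Fin n) {X : Finset (Fin n)}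
    (hX : X ⊆ {i, finRotate n i}) : |∑ j ∈ X, f j| ≤ 1 := by
  have hne : i ≠ finRotate n i := (finRotate_ne_self hn i).symm
  have e : ∑ j ∈ X, f j = (if i ∈ X then f i else 0) +
      (if finRotate n i ∈ X then f (finRotate n i) else 0) := by
    rw [← Finset.sum_pair (f := fun j => if j ∈ X then f j else 0) hne, Finset.sum_ite_mem,
      Finset.inter_eq_right.2 hX]
  rw [e]
  split_ifs
  · exact h2 i
  · simpa using h1 i
  · simpa using h1 _
  · simp

/-- Each pair consists of the possible edges through one vertex of a triangle. The pairs may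
overlap, so they are made disjoint by successive differences, each still a subset of a pair. -/
theorem abs_sum_le_three {n : ℕ} (hn : 3 ≤ n) {f : Fin n → ℤ} (h1 : ∀ i, |f i| ≤ 1)
    (h2 : ∀ i, |f i + f (finRotate n i)| ≤ 1) (a b c : Fin n)
    (h : ∀ i, f i ≠ 0 → i ∈ ({a, finRotate n a} : Finset (Fin n)) ∨
      i ∈ ({b, finRotate n b} : Finset (Fin n)) ∨ i ∈ ({c, finRotate n c} : Finset (Fin n))) :
    |∑ i, f i| ≤ 3 := by
  set A : Finset (Fin n) := {a, finRotate n a} with hA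
  set B : Finset (Fin n) := {b, finRotate n b} with hB
  set C : Finset (Fin n) := {c, finRotate n c} with hC
  have e : ∑ i, f i = ∑ i ∈ A, f i + ∑ i ∈ B \ A, f i + ∑ i ∈ C \ (A ∪ B), f i := by
    rw [← Finset.sum_union Finset.disjoint_sdiff, Finset.union_sdiff_self_eq_union,
      ← Finset.sum_union Finset.disjoint_sdiff, Finset.union_sdiff_self_eq_union]
    refine (Finset.sum_subset (Finset.subset_univ _) fun i _ hi => ?_).symm
    by_contra hne
    apply hi
    rw [Finset.mem_union, Finset.mem_union, or_assoc]
    exact h i hne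
  have k1 := abs_sum_subset_pair_le_one hn h1 h2 a (X := A) subset_rfl
  have k2 := abs_sum_subset_pair_le_one hn h1 h2 b (X := B \ A) Finset.sdiff_subset
  have k3 := abs_sum_subset_pair_le_one hn h1 h2 c (X := C \ (A ∪ B)) Finset.sdiff_subset
  rw [e]
  rw [abs_le] at *
  constructor <;> linarith [k1.1, k1.2, k2.1, k2.2, k3.1, k3.2]

namespace IsEmbeddedPolygon

variable {n : ℕ} {P : Polygon E3 n}

/-- A function of directed segments which is additive along the edges of an embedded polygon has a
potential on the polygon, which jumps at the initial vertex by the total sum. -/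
theorem exists_potential (hP : IsEmbeddedPolygon P) {Φ : E3 → E3 → ℤ} (hΦ : ∀ x, Φ x x = 0)
    {last : Fin n} (hlast : (last : ℕ) + 1 = n) [DecidableEq E3] :
    ∃ F : E3 → ℤ, ∀ (j : Fin n) (x y : E3), x ∈ P.edgeSet ℝ j → y ∈ P.edgeSet ℝ j →
      Φ (P j) y - Φ (P j) x = F y - F x + (∑ i, Φ (P i) (P (finRotate n i))) *
        ((if j = last ∧ y = P (finRotate n last) then 1 else 0) -
          (if j = last ∧ x = P (finRotate n last) then 1 else 0)) := by
  classical
  have hn := hP.three_le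
  set L := ∑ i, Φ (P i) (P (finRotate n i)) with hL
  have hzero : ((finRotate n last : Fin n) : ℕ) = 0 := by rw [val_finRotate, if_pos hlast]
  set z := finRotate n last with hz
  -- `G j x` integrates `Φ` along the polygon from its initial vertex to the point `x` of edge `j`.
  -- It is unambiguous except at `P z`, where it is `0` on the first edge and `L` on the last.
  set G : Fin n → E3 → ℤ := fun j x =>
    ∑ l ∈ ({l | l < j} : Finset (Fin n)), Φ (P l) (P (finRotate n l)) + Φ (P j) x with hG
  have hnext : ∀ i, finRotate n i ≠ z → G i (P (finRotate n i)) =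
      G (finRotate n i) (P (finRotate n i)) := by
    intro i hi
    have hv : ((finRotate n i : Fin n) : ℕ) = i + 1 := by
      rw [val_finRotate, if_neg]
      intro h
      apply hi
      apply Fin.ext
      rw [hzero, val_finRotate, if_pos h]
    have e : ({l | l < finRotate n i} : Finset (Fin n)) = insert i ({l | l < i} : Finset (Fin n)) := by
      ext l
      simp only [Finset.mem_filter, Finset.mem_univ, true_and, Finset.mem_insert, Fin.lt_def,
        Fin.ext_iff, hv]
      omega
    simp only [hG, hΦ]
    rw [e, Finset.sum_insert (by simp)]
    ring
  have hwd : ∀ i j x, x ∈ P.edgeSet ℝ i → x ∈ P.edgeSet ℝ j → x ≠ P z → G i x = G j x := by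
    intro i j x hi hj hx
    by_cases hij : i = j
    · rw [hij]
    rcases hP.eq_of_mem_of_mem hij hi hj with ⟨h, rfl⟩ | ⟨h, rfl⟩
    · subst h
      exact hnext i fun h => hx (by rw [h])
    · subst h
      exact (hnext j fun h => hx (by rw [h])).symm
  set F : E3 → ℤ := fun x => if x = P z then 0 else
    if h : ∃ j, x ∈ P.edgeSet ℝ j then G h.choose x else 0 with hF
  have hGF : ∀ j x, x ∈ P.edgeSet ℝ j →
      G j x = F x + L * (if j = last ∧ x = P z then 1 else 0) := by
    intro j x hx
    by_cases hxz : x = P z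
    · simp only [hF, hxz, if_true, and_true, zero_add]
      by_cases hj : j = last
      · rw [if_pos hj, mul_one, hj, hL]
        have e : (Finset.univ : Finset (Fin n)) = insert last ({l | l < last} : Finset (Fin n)) := by
          ext l
          have := l.2
          simp only [Finset.mem_filter, Finset.mem_univ, true_and, Finset.mem_insert, Fin.lt_def,
            Fin.ext_iff, true_iff]
          omega
        rw [e, Finset.sum_insert (by simp)]
        simp only [hG]
        ring
      · rw [if_neg hj, mul_zero]
        have hjz : j = z := by
          by_contra hne
          have hzz : x ∈ P.edgeSet ℝ z := by
            rw [edgeSet_eq_segment, hxz]; exact left_mem_segment ℝ _ _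
          rcases hP.eq_of_mem_of_mem hne hx hzz with ⟨h, -⟩ | ⟨h, h'⟩
          · exact hj ((finRotate n).injective (h.symm.trans hz))
          · rw [h, hxz] at h'
            exact hP.ne_next z h'
        have e : ({l | l < z} : Finset (Fin n)) = ∅ := by
          rw [Finset.filter_eq_empty_iff]
          intro l _
          rw [Fin.lt_def, hzero]; omega
        rw [hjz]
        simp only [hG, e, hΦ, Finset.sum_empty, add_zero]
    · have h : ∃ j, x ∈ P.edgeSet ℝ j := ⟨j, hx⟩
      simp only [hF, hxz, and_false, if_false, mul_zero, add_zero, dif_pos h]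
      exact hwd _ _ _ hx h.choose_spec hxz
  refine ⟨F, fun j x y hx hy => ?_⟩
  have e : Φ (P j) y - Φ (P j) x = G j y - G j x := by simp only [hG]; ring
  rw [e, hGF j x hx, hGF j y hy]
  ring

end IsEmbeddedPolygon

/-! ### From the surface to the linking number -/

namespace TriangulatedSurface

variable {V : Type*} [Fintype V] [DecidableEq V] {S : TriangulatedSurface V} {p : V → E3} {n : ℕ}
  {P : Polygon E3 n} {O : V → V → V → Prop}

/-- The oriented boundary of the surface is the polygon, up to orientation. -/
theorem Bounds.abs_sum_boundaryCoeff_mul (hB : S.Bounds p P) (hP : IsEmbeddedPolygon P)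
    (hc : S.IsComplementaryImmersed p) (hO : S.IsOrientation O) {Φ : E3 → E3 → ℤ}
    (hΦ : ∀ x, Φ x x = 0)
    (hadd : ∀ j a b, p a ∈ P.edgeSet ℝ j → p b ∈ P.edgeSet ℝ j →
      Φ (p a) (p b) = Φ (P j) (p b) - Φ (P j) (p a)) :
    |∑ a, ∑ b, S.boundaryCoeff O a b * Φ (p a) (p b)| =
      2 * |∑ i, Φ (P i) (P (finRotate n i))| := by
  classical
  have hn := hP.three_le
  obtain ⟨last, hlast⟩ : ∃ last : Fin n, (last : ℕ) + 1 = n :=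
    ⟨⟨n - 1, by omega⟩, by simp only; omega⟩
  obtain ⟨F, hF⟩ := hP.exists_potential hΦ hlast
  obtain ⟨a₀, b₀, h₀, hb₀, hs₀, huniq⟩ := hB.exists_unique_last_edge hP hc last
  set L := ∑ i, Φ (P i) (P (finRotate n i))
  set β := S.boundaryCoeff O
  -- `ind` marks the directed edges that arrive at the jump of the potential; among boundary edges
  -- only `a₀ b₀` does.
  set ind : V → V → ℤ := fun a b =>
    if segment ℝ (p a) (p b) ⊆ P.edgeSet ℝ last ∧ p b = P (finRotate n last) then 1 else 0 with hind
  have hterm : ∀ a b, β a b * Φ (p a) (p b) =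
      β a b * F (p b) - β a b * F (p a) + L * (β a b * ind a b - β a b * ind b a) := by
    intro a b
    by_cases h : β a b = 0
    · simp [h]
    have hab := isBoundaryEdge_of_boundaryCoeff_ne_zero hO h
    suffices e : Φ (p a) (p b) = F (p b) - F (p a) + L * (ind a b - ind b a) by rw [e]; ring
    by_cases hl : segment ℝ (p a) (p b) ⊆ P.edgeSet ℝ last
    · have ha := hl (left_mem_segment ℝ _ _)
      have hb := hl (right_mem_segment ℝ _ _)
      have hl' : segment ℝ (p b) (p a) ⊆ P.edgeSet ℝ last := by rwa [segment_symm]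
      rw [hadd last a b ha hb, hF last _ _ ha hb]
      simp only [hind, hl, hl', true_and]
    · obtain ⟨j, hj⟩ := hB.exists_edge hP hc hab
      have ha := hj (left_mem_segment ℝ _ _)
      have hb := hj (right_mem_segment ℝ _ _)
      have hl' : ¬ segment ℝ (p b) (p a) ⊆ P.edgeSet ℝ last := by rwa [segment_symm]
      have hjl : j ≠ last := by rintro rfl; exact hl hj
      rw [hadd j a b ha hb, hF j _ _ ha hb]
      simp only [hind, hl, hl', hjl, false_and]
  have hind0 : ∑ a, ∑ b, β a b * ind a b = β a₀ b₀ := by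
    have h1 : ∀ a b, ¬ (a = a₀ ∧ b = b₀) → β a b * ind a b = 0 := by
      intro a b hab
      by_contra hne
      obtain ⟨h1, h2⟩ := mul_ne_zero_iff.1 hne
      have h3 : segment ℝ (p a) (p b) ⊆ P.edgeSet ℝ last ∧ p b = P (finRotate n last) := by
        by_contra hcon
        exact h2 (if_neg hcon)
      exact hab (huniq a b (isBoundaryEdge_of_boundaryCoeff_ne_zero hO h1) h3.2 h3.1)
    rw [Finset.sum_eq_single a₀, Finset.sum_eq_single b₀]
    · have : ind a₀ b₀ = 1 := if_pos ⟨hs₀, hb₀⟩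
      rw [this, mul_one]
    · intro b _ hb
      exact h1 _ _ fun h => hb h.2
    · simp
    · intro a _ ha
      exact Finset.sum_eq_zero fun b _ => h1 _ _ fun h => ha h.1
    · simp
  have hind1 : ∑ a, ∑ b, β a b * ind b a = -β a₀ b₀ := by
    rw [Finset.sum_comm, ← hind0]
    simp only [← Finset.sum_neg_distrib, ← neg_mul]
    refine Finset.sum_congr rfl fun a _ => Finset.sum_congr rfl fun b _ => ?_
    rw [← boundaryCoeff_antisymm]
  -- The potential part vanishes because the oriented boundary is a cycle; only the jump survives.
  have hF1 : ∑ a, ∑ b, β a b * F (p a) = 0 := by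
    simp only [← Finset.sum_mul]
    exact Finset.sum_eq_zero fun a _ => by rw [sum_boundaryCoeff hO, zero_mul]
  have hF2 : ∑ a, ∑ b, β a b * F (p b) = 0 := by
    rw [Finset.sum_comm]
    simp only [← Finset.sum_mul]
    refine Finset.sum_eq_zero fun b _ => ?_
    have : ∑ a, β a b = 0 := by
      rw [← neg_eq_zero, ← Finset.sum_neg_distrib, ← sum_boundaryCoeff hO b]
      exact Finset.sum_congr rfl fun a _ => (boundaryCoeff_antisymm a b).symm
    rw [this, zero_mul]
  have htot : ∑ a, ∑ b, β a b * Φ (p a) (p b) = L * (2 * β a₀ b₀) := by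
    simp only [hterm, Finset.sum_add_distrib, Finset.sum_sub_distrib, ← Finset.mul_sum]
    rw [hF1, hF2, hind0, hind1]
    ring
  rw [htot, abs_mul, abs_mul, abs_boundaryCoeff hO h₀]
  simp [mul_comm]

/-- A surface bounded by the polygon has at least a third as many triangles as the linking number
of the polygon with a translate. -/
theorem Bounds.abs_coneLinking_le (hB : S.Bounds p P) (hP : IsEmbeddedPolygon P)
    (hc : S.IsComplementaryImmersed p) (hO : S.IsOrientation O) {w o : E3} {Z : Set E3} (ho : o ∈ Z)
    (hp : ∀ v, p v ∈ Z)
    (hnd : ∀ a b c, {a, b, c} ∈ S.triangles → vol (p a - o) (p b - o) (p c - o) ≠ 0)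
    (hgen : ∀ i, IsGenericSegment Z (P i + w) (P (finRotate n i) + w))
    (hhit : ∀ (i : Fin n) (a b c : V), {a, b, c} ∈ S.triangles →
      Hits (P i + w) (P (finRotate n i) + w) (p a) (p b) (p c) →
        p a ∈ P.edgeSet ℝ i ∨ p b ∈ P.edgeSet ℝ i ∨ p c ∈ P.edgeSet ℝ i) :
    |coneLinking P w o| ≤ 3 * #S.triangles := by
  have hn := hP.three_le
  set Φ : E3 → E3 → ℤ := fun x y =>
    ∑ i, signedHit (P i + w) (P (finRotate n i) + w) o x y
  have hΦ : ∀ x, Φ x x = 0 := fun x => Finset.sum_eq_zero fun i _ => signedHit_self _ _ _ _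
  have hanti : ∀ x y, Φ y x = -Φ x y := fun x y => by
    simp only [Φ, ← Finset.sum_neg_distrib]
    exact Finset.sum_congr rfl fun i _ => signedHit_antisymm _ _ _ _ _
  have hsplit : ∀ (x y : E3) (v : V), p v ∈ segment ℝ x y → Φ x (p v) + Φ (p v) y = Φ x y := by
    intro x y v h
    simp only [Φ, ← Finset.sum_add_distrib]
    exact Finset.sum_congr rfl fun i _ =>
      signedHit_add_of_mem_segment h ((hgen i).disjoint o ho _ (hp v))
  have hadd : ∀ j a b, p a ∈ P.edgeSet ℝ j → p b ∈ P.edgeSet ℝ j →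
      Φ (p a) (p b) = Φ (P j) (p b) - Φ (P j) (p a) := by
    intro j a b ha hb
    rw [edgeSet_eq_segment] at ha hb
    have order : ∀ {x y u v : E3}, u ∈ segment ℝ x y → v ∈ segment ℝ x y →
        u ∈ segment ℝ x v ∨ v ∈ segment ℝ x u := by
      have key : ∀ {x y : E3} {r s : ℝ}, 0 ≤ r → r ≤ s →
          (1 - r) • x + r • y ∈ segment ℝ x ((1 - s) • x + s • y) := by
        intro x y r s r0 hrs
        rcases eq_or_lt_of_le (r0.trans hrs) with h | hs
        · obtain rfl : r = 0 := by linarith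
          simpa using left_mem_segment ℝ x _
        · have e : (1 - r) • x + r • y = (1 - r / s) • x + (r / s) • ((1 - s) • x + s • y) := by
            rw [smul_add, smul_smul, smul_smul, div_mul_cancel₀ _ hs.ne']
            have : r / s * (1 - s) = r / s - r := by field_simp
            rw [this]; module
          rw [e]
          exact combo_mem_segment (div_nonneg r0 hs.le) ((div_le_one hs).2 hrs)
      intro x y u v hu hv
      obtain ⟨r, r0, -, rfl⟩ := exists_combo_of_mem_segment hu
      obtain ⟨s, s0, -, rfl⟩ := exists_combo_of_mem_segment hv
      rcases le_total r s with h | h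
      · exact Or.inl (key r0 h)
      · exact Or.inr (key s0 h)
    rcases order ha hb with h | h
    · linarith [hsplit _ _ _ h]
    · linarith [hsplit _ _ _ h, hanti (p a) (p b)]
  have h1 := two_mul_sum_signedHit hO (fun i => P i + w) ho hp hnd hgen
  have h2 := hB.abs_sum_boundaryCoeff_mul hP hc hO hΦ hadd
  have h3 : ∑ i, Φ (P i) (P (finRotate n i)) = coneLinking P w o := by
    rw [coneLinking, Finset.sum_comm]
  have h4 : |∑ q ∈ S.orientedTriangles O, ∑ i,
      signedHit (P i + w) (P (finRotate n i) + w) (p q.1) (p q.2.1) (p q.2.2)| ≤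
      3 * #(S.orientedTriangles O) := by
    refine (Finset.abs_sum_le_sum_abs _ _).trans ?_
    rw [mul_comm, ← nsmul_eq_mul]
    refine Finset.sum_le_card_nsmul _ _ _ ?_
    rintro ⟨a, b, c⟩ hq
    obtain ⟨ia, hia⟩ := hP.exists_edges_of_point (p a)
    obtain ⟨ib, hib⟩ := hP.exists_edges_of_point (p b)
    obtain ⟨ic, hic⟩ := hP.exists_edges_of_point (p c)
    refine abs_sum_le_three hn (fun i => abs_signedHit_le_one _ _ _ _ _)
      (fun i => abs_signedHit_add_le_one ((hgen i).right _ (hp a) _ (hp b) _ (hp c))) ia ib ic ?_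
    intro i hi
    simp only [Finset.mem_insert, Finset.mem_singleton]
    rcases hhit i a b c (mem_orientedTriangles.1 hq).1 (hits_of_signedHit_ne_zero hi) with h | h | h
    · exact Or.inl (hia i h)
    · exact Or.inr (Or.inl (hib i h))
    · exact Or.inr (Or.inr (hic i h))
  have h5 := card_orientedTriangles_le hO
  -- Twice the surface sum is `3 * (2 * |coneLinking P w o|)` in absolute value; the surface sum is
  -- at most `3` per oriented triple, with at most three triples per triangle.
  have h6 := congrArg abs h1
  rw [abs_mul, abs_mul, h2, h3, abs_two, abs_of_pos (by norm_num : (0 : ℤ) < 3)] at h6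
  have h7 : (#(S.orientedTriangles O) : ℤ) ≤ 3 * #S.triangles := by exact_mod_cast h5
  linarith

end TriangulatedSurface

/-! ### The quadratic lower bound -/

theorem theorem1p3 :
    {n : ℕ | ∃ P : Polygon E3 n, IsEmbeddedPolygon P ∧
      ∀ (V : Type) [Fintype V] [DecidableEq V] (S : TriangulatedSurface V) (p : V → E3),
        S.Orientable → S.IsComplementaryImmersed p → S.Bounds p P →
          (n : ℝ) ^ 2 / 36 ≤ (#S.triangles : ℝ)}.Infinite := by
  refine Set.infinite_of_forall_exists_gt fun N => ?_
  obtain ⟨P, hP, o₀, hev⟩ := exists_polygon_coneLinking (k := N + 124) (by omega)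
  refine ⟨3 * (N + 124), ⟨P, hP, ?_⟩, by omega⟩
  rintro V _ _ S p ⟨O, hO⟩ hc hB
  obtain ⟨ε, ε0, hε⟩ := Metric.eventually_nhds_iff.1
    (hev.and ((continuous_fst.tendsto ((0 : E3), o₀)).eventually
      (hB.eventually_vertex_mem_edge hP hc)))
  -- The moved apex `o₀ + v` avoids the planes of all triangles, so the tetrahedra over them are
  -- nondegenerate.
  obtain ⟨v, hv, hvo⟩ := exists_small_avoiding (fun q : V × V × V => p q.1 - o₀)
    (fun q => p q.2.1 - p q.1) (fun q => p q.2.2 - p q.1) ε0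
  obtain ⟨w, hw, hgen⟩ := exists_small_generic (fun i => P i) (fun i => P (finRotate _ i))
    (Z := insert (o₀ + v) (Set.range p)) ((Set.finite_range p).insert _) ε0
  have hd : dist (w, o₀ + v) ((0 : E3), o₀) < ε := by
    rw [Prod.dist_eq, max_lt_iff]
    simp [dist_eq_norm, hw, hv]
  obtain ⟨h1, h2⟩ := hε hd
  have h3 := hB.abs_coneLinking_le hP hc hO (w := w) (Set.mem_insert (o₀ + v) _)
    (fun v => Set.mem_insert_of_mem _ (Set.mem_range_self v)) (by
      intro a b c ht h0
      refine hvo (a, b, c) ?_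
      refine mem_span_of_vol_eq_zero ?_ fun r s h => hc.eq_zero_of_combo ht h
      rw [← neg_eq_zero, ← h0]
      simp [vol]; ring) hgen h2
  -- With `k = N + 124`, the two bounds on the linking number give `3 * k ^ 2 ≤ 4 * (3 *
  -- #S.triangles)`, and `n = 3 * k` turns `k ^ 2 / 4` into `n ^ 2 / 36`.
  have h4 : ((N + 124 : ℕ) : ℤ) ^ 2 ≤ 4 * #S.triangles := by
    dsimp only at h1
    linarith
  have h5 : ((N + 124 : ℕ) : ℝ) ^ 2 ≤ 4 * #S.triangles := by exact_mod_cast h4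
  rw [Nat.cast_mul]
  push_cast at h5 ⊢
  linarith
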